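/- Let $G=(V,E)$ be a finite undirected graph (parallel edges allowed) with $E\neq\emptyset$. A biset on $V$ is a pair $\hat S=(S,S^+)$ of sets $S\subseteq S^+\subseteq V$; its boundary is $\Gamma(\hat S)=S^+\setminus S$; $\delta_E(\hat S)$ is the set of edges in $E$ with one end-node in $S$ and the other in $V\setminus S^+$; and $\delta_E(v)=\delta_E((\{v\},\{v\}))$ for $v\in V$. For bisets $\hat X,\hat Y$ put $\hat X\cap\hat Y=(X\cap Y,X^+\cap Y^+)$, $\hat X\cup\hat Y=(X\cup Y,X^+\cup Y^+)$ and $\hat X\setminus\hat Y=(X\setminus Y^+,X^+\setminus Y)$. Let $f$ be an integer-valued function on the bisets on $V$ that is skew supermodular, i.e. any bisets $\hat X,\hat Y$ satisfy $$f(\hat X)+f(\hat Y)\le f(\hat X\cap\hat Y)+f(\hat X\cup\hat Y)\quad\text{or}\quad f(\hat X)+f(\hat Y)\le f(\hat X\setminus\hat Y)+f(\hat Y\setminus\hat X).$$ Let $\gamma=\max\{|\Gamma(\hat S)| : f(\hat S)>0\}$ (with $\gamma=0$ if $f$ is nowhere positive), let $B\subseteq V$ and $b\colon B\to\mathbb R$,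 and let $P(f,b,E)$ be the polytope of all $x\in[0,1]^E$ with $\sum_{e\in\delta_E(\hat S)}x(e)\ge f(\hat S)$ for every biset $\hat S$ on $V$ and $\sum_{e\in\delta_E(v)}x(e)\le b(v)$ for every $v\in B$. Let $x^*$ be an extreme point of $P(f,b,E)$. Then the following holds. (i) For any integer $\alpha\ge 4$, there is $e\in E$ with $x^*(e)=0$ or $x^*(e)\ge 1/\alpha$, or there is $v\in B$ with $|\delta_E(v)|\le\left\lceil 4\,\frac{\gamma+2}{\alpha-2}\right\rceil+5$. (ii) If every edge in $E$ is incident to some node in $B$, then there is $e\in E$ with $x^*(e)=0$ or $x^*(e)\ge 1/2$, or there is $v\in B$ with $|\delta_E(v)|\le 1.5\gamma^2+7.5\gamma+16$. -/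

import Mathlib

/-- A biset on `V`: an ordered pair `(S, S⁺)` of subsets of `V` with `S ⊆ S⁺`. -/
@[ext]
structure Biset (V : Type*) where
  /-- The inner part `S`. -/
  innerPart : Finset V
  /-- The outer part `S⁺`. -/
  outerPart : Finset V
  subset : innerPart ⊆ outerPart

namespace Biset

variable {V : Type*} [DecidableEq V]

/-- The boundary `Γ(S, S⁺) = S⁺ \ S`. -/
def boundary (S : Biset V) : Finset V := S.outerPart \ S.innerPart

/-- A node `v` regarded as the biset `({v}, {v})`. -/
def single {V : Type*} (v : V) : Biset V := ⟨{v}, {v}, Finset.Subset.refl _⟩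

/-- `X ∩ Y = (X ∩ Y, X⁺ ∩ Y⁺)`. -/
instance : Inter (Biset V) :=
  ⟨fun X Y => ⟨X.innerPart ∩ Y.innerPart, X.outerPart ∩ Y.outerPart,
    Finset.inter_subset_inter X.subset Y.subset⟩⟩

/-- `X ∪ Y = (X ∪ Y, X⁺ ∪ Y⁺)`. -/
instance : Union (Biset V) :=
  ⟨fun X Y => ⟨X.innerPart ∪ Y.innerPart, X.outerPart ∪ Y.outerPart,
    Finset.union_subset_union X.subset Y.subset⟩⟩

/-- `X \ Y = (X \ Y⁺, X⁺ \ Y)`. -/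
instance : SDiff (Biset V) :=
  ⟨fun X Y => ⟨X.innerPart \ Y.outerPart, X.outerPart \ Y.innerPart,
    Finset.sdiff_subset_sdiff X.subset Y.subset⟩⟩

/-- There are finitely many bisets on a finite ground set. -/
noncomputable instance {V : Type*} [Fintype V] : Fintype (Biset V) :=
  Fintype.ofInjective (fun S : Biset V => (S.innerPart, S.outerPart))
    (fun _ _ h => Biset.ext (congrArg Prod.fst h) (congrArg Prod.snd h))

/-- `f` is skew supermodular: any two bisets satisfy the supermodular inequality or the
posimodular inequality. -/
def SkewSupermodular (f : Biset V → ℤ) : Prop :=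
  ∀ X Y : Biset V, f X + f Y ≤ f (X ∩ Y) + f (X ∪ Y) ∨ f X + f Y ≤ f (X \ Y) + f (Y \ X)

/-- `γ_f`, the maximum of `|Γ(S)|` over the bisets `S` with `f(S) > 0`
(and `0` if there is no such biset). -/
noncomputable def gamma [Fintype V] (f : Biset V → ℤ) : ℕ :=
  (Finset.univ.filter (fun S : Biset V => 0 < f S)).sup (fun S => S.boundary.card)

end Biset

/-! An undirected graph with node set `V` and edge set `E` is given by the map
`ends : E → Sym2 V` sending an edge to its unordered pair of end-nodes. -/

/-- The edge `e` covers the biset `S`: one end-node is in `S`, the other in `V \ S⁺`. -/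
def EdgeCovers {V E : Type*} (ends : E → Sym2 V) (e : E) (S : Biset V) : Prop :=
  ∃ u v : V, ends e = s(u, v) ∧ u ∈ S.innerPart ∧ v ∉ S.outerPart

open Classical in
/-- `δ_E(S)`, the set of edges covering the biset `S`. -/
noncomputable def edgeCut {V E : Type*} [Fintype E] (ends : E → Sym2 V) (S : Biset V) :
    Finset E :=
  Finset.univ.filter (fun e => EdgeCovers ends e S)

/-- `P(f, b, E)`: the polytope of all `x ∈ [0,1]^E` with `x(δ_E(S)) ≥ f(S)` for each biset `S`
and `x(δ_E(v)) ≤ b(v)` for each `v ∈ B`. -/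
def bisetPolytope {V E : Type*} [Fintype E] (ends : E → Sym2 V) (f : Biset V → ℤ)
    (B : Finset V) (b : B → ℝ) : Set (E → ℝ) :=
  {x | (∀ S : Biset V, (f S : ℝ) ≤ ∑ e ∈ edgeCut ends S, x e) ∧
       (∀ v : B, ∑ e ∈ edgeCut ends (Biset.single (v : V)), x e ≤ b v) ∧
       (∀ e : E, 0 ≤ x e ∧ x e ≤ 1)}

/-! Suppose every coordinate of x is positive and below the threshold. Then no box constraint is
tight, so x is pinned down by tight bisets and degree constraints. Uncrossing
(`exists_laminar_basis`) yields a laminar family L with independent cut vectors that span all tight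
cuts, whence |E| ≤ |L| + |B| (`card_le_of_extreme`). Adding (V,V) as a root gives a forest F with
|E| + 1 ≤ |F| + |B|.

Split each edge into two directed copies. The members that a copy leaves form a chain: it starts at
the least one and stops at the parent of the greatest one. The weight starting at S minus the weight
stopping there is an integer (`integral_balance`), and by independence something starts or stops at
every S (`IsForest.exists_move`). As weights are small, a leaf has many starts, and a member with
one child has both starts and stops, or many of one kind. Only branchings may fall short, and there
are fewer of them than leaves.

Nodes of B disturb this count in two ways. A copy starting from B makes S the home of a node of B,
which happens for at most |B| members. At a one-child member that is no home, a copy stopping alone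
with its head in B makes a node of B enter the boundary; with ℓ leaves this occurs at most |B| + γ(ℓ
- 1) times (`IsForest.sum_entering_le`).

For (i), if all degrees were large, summing `le_surplus` over F would contradict the bound on |E|.
For (ii), each edge hands out one token in fractions; every member gets a positive integer
(`one_le_tokens`), so the total surplus is at most |B| - 1. Incidence with B bounds the starts from
B by a `charge`, and `charge_le` turns the surplus into ℓ ≤ 11|B| and then into an average degree
below 11γ + 13. -/

namespace Biset

/-- Bisets are ordered by componentwise inclusion. -/
instance instPartialOrder {V : Type*} : PartialOrder (Biset V) :=
  PartialOrder.lift (fun S : Biset V => (S.innerPart, S.outerPart))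
    (fun _ _ h => Biset.ext (congrArg Prod.fst h) (congrArg Prod.snd h))

/-! ### Laminarity and uncrossing of bisets. -/

section Order

variable {V : Type*} [DecidableEq V] {X Y Z : Biset V}

/-- Each of the two bisets has its inner part disjoint from the outer part of the other. -/
def StronglyDisjoint {V : Type*} (X Y : Biset V) : Prop :=
  (∀ v ∈ X.innerPart, v ∉ Y.outerPart) ∧ (∀ v ∈ Y.innerPart, v ∉ X.outerPart)

/-- Two bisets are laminar if they are comparable or strongly disjoint. -/
def Laminar {V : Type*} (X Y : Biset V) : Prop := X ≤ Y ∨ Y ≤ X ∨ StronglyDisjoint X Y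

theorem Laminar.symm {V : Type*} {X Y : Biset V} (h : Laminar X Y) : Laminar Y X := by
  rcases h with h | h | h
  · exact Or.inr (Or.inl h)
  · exact Or.inl h
  · exact Or.inr (Or.inr ⟨h.2, h.1⟩)

theorem inter_le_left : X ∩ Y ≤ X := ⟨Finset.inter_subset_left, Finset.inter_subset_left⟩
theorem inter_le_right : X ∩ Y ≤ Y := ⟨Finset.inter_subset_right, Finset.inter_subset_right⟩
theorem le_union_left : X ≤ X ∪ Y := ⟨Finset.subset_union_left, Finset.subset_union_left⟩
theorem le_union_right : Y ≤ X ∪ Y := ⟨Finset.subset_union_right, Finset.subset_union_right⟩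
theorem sdiff_le_left : X \ Y ≤ X := ⟨Finset.sdiff_subset, Finset.sdiff_subset⟩
theorem le_inter (h₁ : Z ≤ X) (h₂ : Z ≤ Y) : Z ≤ X ∩ Y :=
  ⟨Finset.subset_inter h₁.1 h₂.1, Finset.subset_inter h₁.2 h₂.2⟩
theorem union_le (h₁ : X ≤ Z) (h₂ : Y ≤ Z) : X ∪ Y ≤ Z :=
  ⟨Finset.union_subset h₁.1 h₂.1, Finset.union_subset h₁.2 h₂.2⟩

theorem le_sdiff (h₁ : Z ≤ X) (h₂ : StronglyDisjoint Z Y) : Z ≤ X \ Y :=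
  ⟨fun _ hv => Finset.mem_sdiff.2 ⟨h₁.1 hv, h₂.1 _ hv⟩,
    fun _ hv => Finset.mem_sdiff.2 ⟨h₁.2 hv, fun hy => h₂.2 _ hy hv⟩⟩

theorem stronglyDisjoint_sdiff : StronglyDisjoint (X \ Y) Y :=
  ⟨fun _ hv => (Finset.mem_sdiff.1 hv).2, fun _ hv hx => (Finset.mem_sdiff.1 hx).2 hv⟩

theorem StronglyDisjoint.symm {V : Type*} {X Y : Biset V} (h : StronglyDisjoint X Y) :
    StronglyDisjoint Y X := ⟨h.2, h.1⟩

theorem StronglyDisjoint.mono_left {V : Type*} {X Y Z : Biset V} (h : StronglyDisjoint Y Z)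
    (hXY : X ≤ Y) : StronglyDisjoint X Z :=
  ⟨fun v hv => h.1 v (hXY.1 hv), fun v hv hx => h.2 v hv (hXY.2 hx)⟩

theorem StronglyDisjoint.mono_right {V : Type*} {X Y Z : Biset V} (h : StronglyDisjoint X Z)
    (hYZ : Y ≤ Z) : StronglyDisjoint X Y := (h.symm.mono_left hYZ).symm

theorem StronglyDisjoint.union (h₁ : StronglyDisjoint X Z) (h₂ : StronglyDisjoint Y Z) :
    StronglyDisjoint (X ∪ Y) Z :=
  ⟨fun v hv => (Finset.mem_union.1 hv).elim (h₁.1 v) (h₂.1 v),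
    fun v hv hx => (Finset.mem_union.1 hx).elim (h₁.2 v hv) (h₂.2 v hv)⟩

/-- A biset laminar to both of two crossing bisets is laminar to what uncrossing them yields. -/
theorem laminar_uncross (hX : Laminar Z X) (hY : Laminar Z Y) (hXY : ¬ Laminar X Y) :
    Laminar Z (X ∩ Y) ∧ Laminar Z (X ∪ Y) ∧ Laminar Z (X \ Y) ∧ Laminar Z (Y \ X) := by
  -- Four of the nine relative positions would make X and Y laminar and are excluded by `hXY`.
  rcases hX with hX | hX | hX <;> rcases hY with hY | hY | hY
  · exact ⟨Or.inl (le_inter hX hY), Or.inl (hX.trans le_union_left),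
      Or.inr (Or.inr (stronglyDisjoint_sdiff.symm.mono_left hY)),
      Or.inr (Or.inr (stronglyDisjoint_sdiff.symm.mono_left hX))⟩
  · exact absurd (Or.inr (Or.inl (hY.trans hX))) hXY
  · exact ⟨Or.inr (Or.inr (hY.mono_right inter_le_right)), Or.inl (hX.trans le_union_left),
      Or.inl (le_sdiff hX hY), Or.inr (Or.inr (hY.mono_right sdiff_le_left))⟩
  · exact absurd (Or.inl (hX.trans hY)) hXY
  · exact ⟨Or.inr (Or.inl (inter_le_left.trans hX)), Or.inr (Or.inl (union_le hX hY)),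
      Or.inr (Or.inl (sdiff_le_left.trans hX)), Or.inr (Or.inl (sdiff_le_left.trans hY))⟩
  · exact absurd (Or.inr (Or.inr (hY.mono_left hX))) hXY
  · exact ⟨Or.inr (Or.inr (hX.mono_right inter_le_left)), Or.inl (hY.trans le_union_right),
      Or.inr (Or.inr (hX.mono_right sdiff_le_left)), Or.inl (le_sdiff hY hX)⟩
  · exact absurd (Or.inr (Or.inr (hX.symm.mono_right hY))) hXY
  · exact ⟨Or.inr (Or.inr (hX.mono_right inter_le_left)),
      Or.inr (Or.inr (hX.symm.union hY.symm).symm),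
      Or.inr (Or.inr (hX.mono_right sdiff_le_left)),
      Or.inr (Or.inr (hY.mono_right sdiff_le_left))⟩

end Order

end Biset

/-! ### Cut vectors and their edgewise sub- and posimodularity. -/

section Cut

open Classical in
/-- The incidence vector of the cut `δ_E(S)`. -/
noncomputable def cutVec {V E : Type*} (ends : E → Sym2 V) (S : Biset V) : E → ℝ :=
  fun e => if EdgeCovers ends e S then 1 else 0

variable {V E : Type*} (ends : E → Sym2 V)

theorem sum_edgeCut [Fintype E] (S : Biset V) (x : E → ℝ) :
    ∑ e ∈ edgeCut ends S, x e = ∑ e, cutVec ends S e * x e := by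
  classical
  simp [edgeCut, cutVec, Finset.sum_filter]

theorem edgeCovers_mk {e : E} {u v : V} (h : ends e = s(u, v)) (S : Biset V) :
    EdgeCovers ends e S ↔ (u ∈ S.innerPart ∧ v ∉ S.outerPart) ∨
      (v ∈ S.innerPart ∧ u ∉ S.outerPart) := by
  constructor
  · rintro ⟨a, b, hab, ha, hb⟩
    rw [h, Sym2.eq_iff] at hab
    rcases hab with ⟨rfl, rfl⟩ | ⟨rfl, rfl⟩
    · exact Or.inl ⟨ha, hb⟩
    · exact Or.inr ⟨ha, hb⟩
  · rintro (⟨ha, hb⟩ | ⟨ha, hb⟩)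
    · exact ⟨u, v, h, ha, hb⟩
    · exact ⟨v, u, h.trans Sym2.eq_swap, ha, hb⟩

variable [DecidableEq V]

/-- The incidence vector of a cut in terms of the two end-nodes of an edge. -/
theorem cutVec_eq {e : E} {u v : V} (h : ends e = s(u, v)) (S : Biset V) :
    cutVec ends S e = (if u ∈ S.innerPart then if v ∈ S.outerPart then (0 : ℝ) else 1 else 0) +
      (if v ∈ S.innerPart then if u ∈ S.outerPart then (0 : ℝ) else 1 else 0) := by
  have h1 := @S.subset u
  have h2 := @S.subset v
  unfold cutVec
  rw [edgeCovers_mk ends h]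
  grind

theorem cutVec_submodular (X Y : Biset V) (e : E) :
    cutVec ends (X ∩ Y) e + cutVec ends (X ∪ Y) e ≤ cutVec ends X e + cutVec ends Y e := by
  obtain ⟨⟨u, v⟩, huv⟩ := Quot.exists_rep (ends e)
  simp only [cutVec_eq ends (u := u) (v := v) huv.symm]
  have h1 := @X.subset u
  have h2 := @X.subset v
  have h3 := @Y.subset u
  have h4 := @Y.subset v
  have e1 : ∀ w, w ∈ (X ∩ Y).innerPart ↔ w ∈ X.innerPart ∧ w ∈ Y.innerPart :=
    fun _ => Finset.mem_inter
  have e2 : ∀ w, w ∈ (X ∩ Y).outerPart ↔ w ∈ X.outerPart ∧ w ∈ Y.outerPart :=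
    fun _ => Finset.mem_inter
  have e3 : ∀ w, w ∈ (X ∪ Y).innerPart ↔ w ∈ X.innerPart ∨ w ∈ Y.innerPart :=
    fun _ => Finset.mem_union
  have e4 : ∀ w, w ∈ (X ∪ Y).outerPart ↔ w ∈ X.outerPart ∨ w ∈ Y.outerPart :=
    fun _ => Finset.mem_union
  simp only [e1, e2, e3, e4]
  grind

theorem cutVec_posimodular (X Y : Biset V) (e : E) :
    cutVec ends (X \ Y) e + cutVec ends (Y \ X) e ≤ cutVec ends X e + cutVec ends Y e := by
  obtain ⟨⟨u, v⟩, huv⟩ := Quot.exists_rep (ends e)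
  simp only [cutVec_eq ends (u := u) (v := v) huv.symm]
  have h1 := @X.subset u
  have h2 := @X.subset v
  have h3 := @Y.subset u
  have h4 := @Y.subset v
  have e1 : ∀ (X Y : Biset V) w, w ∈ (X \ Y).innerPart ↔ w ∈ X.innerPart ∧ w ∉ Y.outerPart :=
    fun _ _ _ => Finset.mem_sdiff
  have e2 : ∀ (X Y : Biset V) w, w ∈ (X \ Y).outerPart ↔ w ∈ X.outerPart ∧ w ∉ Y.innerPart :=
    fun _ _ _ => Finset.mem_sdiff
  simp only [e1, e2]
  grind

end Cut

/-! ### Tight constraints at an extreme point. -/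

section Polyhedron

variable {V E : Type*} [Fintype E] (ends : E → Sym2 V)

/-- The biset `S` attains its covering constraint with equality at `x`. -/
def TightAt (f : Biset V → ℤ) (x : E → ℝ) (S : Biset V) : Prop :=
  (f S : ℝ) = ∑ e, cutVec ends S e * x e

section Uncrossing

variable {f : Biset V → ℤ} {x : E → ℝ}

/-- The values of f bound the cut weights of X' and Y' from below, and those of X and Y bound them
from above; the two bounds force equality throughout. Since x is positive, equality of the weighted
sums is equality at every edge. -/
theorem tight_pair_of_le (hpos : ∀ e, 0 < x e)
    (hcov : ∀ S : Biset V, (f S : ℝ) ≤ ∑ e, cutVec ends S e * x e) {X Y X' Y' : Biset V}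
    (hX : TightAt ends f x X) (hY : TightAt ends f x Y) (hf : f X + f Y ≤ f X' + f Y')
    (hc : ∀ e, cutVec ends X' e + cutVec ends Y' e ≤ cutVec ends X e + cutVec ends Y e) :
    TightAt ends f x X' ∧ TightAt ends f x Y' ∧
      cutVec ends X + cutVec ends Y = cutVec ends X' + cutVec ends Y' := by
  unfold TightAt at *
  have hf' : (f X : ℝ) + f Y ≤ f X' + f Y' := by exact_mod_cast hf
  have h1 := hcov X'
  have h2 := hcov Y'
  have hterm : ∀ e ∈ Finset.univ, (cutVec ends X' e + cutVec ends Y' e) * x e ≤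
      (cutVec ends X e + cutVec ends Y e) * x e :=
    fun e _ => mul_le_mul_of_nonneg_right (hc e) (hpos e).le
  have hsum := Finset.sum_le_sum hterm
  have hs : ∀ A B : Biset V, ∑ e, (cutVec ends A e + cutVec ends B e) * x e =
      ∑ e, cutVec ends A e * x e + ∑ e, cutVec ends B e * x e := by
    intro A B
    simp only [add_mul, Finset.sum_add_distrib]
  rw [hs, hs] at hsum
  refine ⟨by linarith, by linarith, ?_⟩
  have heq : ∑ e, (cutVec ends X' e + cutVec ends Y' e) * x e =
      ∑ e, (cutVec ends X e + cutVec ends Y e) * x e := by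
    rw [hs, hs]; linarith
  have := (Finset.sum_eq_sum_iff_of_le hterm).1 heq
  funext e
  exact (mul_right_cancel₀ (hpos e).ne' (this e (Finset.mem_univ e))).symm

/-- Both new bisets keep every laminar relation shared by X and Y and are in addition laminar to Y;
this makes the number of crossings drop in `exists_laminar_basis`. -/
theorem exists_uncrossing [DecidableEq V] (hfs : Biset.SkewSupermodular f) (hpos : ∀ e, 0 < x e)
    (hcov : ∀ S : Biset V, (f S : ℝ) ≤ ∑ e, cutVec ends S e * x e) {X Y : Biset V}
    (hX : TightAt ends f x X) (hY : TightAt ends f x Y) (hXY : ¬ Biset.Laminar X Y) :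
    ∃ X' Y' : Biset V, TightAt ends f x X' ∧ TightAt ends f x Y' ∧
      cutVec ends X + cutVec ends Y = cutVec ends X' + cutVec ends Y' ∧
      (∀ Z, Biset.Laminar Z X → Biset.Laminar Z Y → Biset.Laminar Z X' ∧ Biset.Laminar Z Y') ∧
      Biset.Laminar Y X' ∧ Biset.Laminar Y Y' := by
  rcases hfs X Y with h | h
  · obtain ⟨h1, h2, h3⟩ := tight_pair_of_le ends hpos hcov hX hY h (cutVec_submodular ends X Y)
    exact ⟨_, _, h1, h2, h3, fun Z hZX hZY =>
      ⟨(Biset.laminar_uncross hZX hZY hXY).1, (Biset.laminar_uncross hZX hZY hXY).2.1⟩,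
      Or.inr (Or.inl Biset.inter_le_right), Or.inl Biset.le_union_right⟩
  · obtain ⟨h1, h2, h3⟩ := tight_pair_of_le ends hpos hcov hX hY h (cutVec_posimodular ends X Y)
    exact ⟨_, _, h1, h2, h3, fun Z hZX hZY =>
      ⟨(Biset.laminar_uncross hZX hZY hXY).2.2.1, (Biset.laminar_uncross hZX hZY hXY).2.2.2⟩,
      Or.inr (Or.inr Biset.stronglyDisjoint_sdiff.symm), Or.inr (Or.inl Biset.sdiff_le_left)⟩

/-- The tight bisets are spanned by a laminar family with independent incidence vectors. -/
theorem exists_laminar_basis [Fintype V] [DecidableEq V]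
    (hfs : Biset.SkewSupermodular f) (hpos : ∀ e, 0 < x e)
    (hcov : ∀ S : Biset V, (f S : ℝ) ≤ ∑ e, cutVec ends S e * x e) :
    ∃ L : Finset (Biset V), (∀ S ∈ L, TightAt ends f x S) ∧
      (∀ S ∈ L, ∀ T ∈ L, Biset.Laminar S T) ∧
      LinearIndepOn ℝ (cutVec ends) (L : Set (Biset V)) ∧
      ∀ S, TightAt ends f x S →
        cutVec ends S ∈ Submodule.span ℝ (cutVec ends '' (L : Set (Biset V))) := by
  classical
  let good : Finset (Finset (Biset V)) := Finset.univ.filter fun L =>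
    (∀ S ∈ L, TightAt ends f x S) ∧ (∀ S ∈ L, ∀ T ∈ L, Biset.Laminar S T) ∧
      LinearIndepOn ℝ (cutVec ends) (L : Set (Biset V))
  have hgood : good.Nonempty := ⟨∅, by simp [good]⟩
  obtain ⟨L, hL, hmax⟩ := Finset.exists_max_image good Finset.card hgood
  obtain ⟨ht, hlam, hind⟩ := (Finset.mem_filter.1 hL).2
  refine ⟨L, ht, hlam, hind, ?_⟩
  by_contra! hne
  let bad : Finset (Biset V) := Finset.univ.filter fun S => TightAt ends f x S ∧
    cutVec ends S ∉ Submodule.span ℝ (cutVec ends '' (L : Set (Biset V)))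
  have hbad : bad.Nonempty := by
    obtain ⟨S, hS⟩ := hne
    exact ⟨S, by simpa [bad] using hS⟩
  let crossing : Biset V → Finset (Biset V) := fun S => L.filter fun Z => ¬ Biset.Laminar Z S
  -- Among tight cuts outside the span, take one crossing the fewest members of L. Uncrossing it
  -- with such a member gives two cuts already in the span; if it crosses none, it could be added to
  -- the maximal L.
  obtain ⟨X, hX, hmin⟩ := Finset.exists_min_image bad (fun S => (crossing S).card) hbad
  obtain ⟨hXt, hXs⟩ := (Finset.mem_filter.1 hX).2
  by_cases hc : ∃ Y ∈ L, ¬ Biset.Laminar Y X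
  · obtain ⟨Y, hY, hYX⟩ := hc
    obtain ⟨X', Y', hX', hY', hsum, hZ, hYX', hYY'⟩ := exists_uncrossing ends hfs hpos hcov hXt
      (ht Y hY) (fun h => hYX h.symm)
    have hlt : ∀ W, (∀ Z, Biset.Laminar Z X → Biset.Laminar Z Y → Biset.Laminar Z W) →
        Biset.Laminar Y W → (crossing W).card < (crossing X).card := by
      intro W hW hYW
      refine Finset.card_lt_card ⟨fun Z hZ => ?_, fun hsub => ?_⟩
      · obtain ⟨hZL, hZW⟩ := Finset.mem_filter.1 hZ
        exact Finset.mem_filter.2 ⟨hZL, fun h => hZW (hW Z h (hlam Z hZL Y hY))⟩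
      · exact (Finset.mem_filter.1 (hsub (Finset.mem_filter.2 ⟨hY, hYX⟩))).2 hYW
    have hin : ∀ W, TightAt ends f x W →
        (∀ Z, Biset.Laminar Z X → Biset.Laminar Z Y → Biset.Laminar Z W) →
        Biset.Laminar Y W →
        cutVec ends W ∈ Submodule.span ℝ (cutVec ends '' (L : Set (Biset V))) := by
      intro W hWt hW hYW
      by_contra hWs
      exact (hmin W (Finset.mem_filter.2 ⟨Finset.mem_univ _, hWt, hWs⟩)).not_gt (hlt W hW hYW)
    apply hXs
    have h1 := hin X' hX' (fun Z a b => (hZ Z a b).1) hYX'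
    have h2 := hin Y' hY' (fun Z a b => (hZ Z a b).2) hYY'
    have h3 : cutVec ends Y ∈ Submodule.span ℝ (cutVec ends '' (L : Set (Biset V))) :=
      Submodule.subset_span ⟨Y, hY, rfl⟩
    rw [eq_sub_of_add_eq hsum]
    exact Submodule.sub_mem _ (Submodule.add_mem _ h1 h2) h3
  · push Not at hc
    have hXL : X ∉ L := fun h => hXs (Submodule.subset_span ⟨X, h, rfl⟩)
    have hins : insert X L ∈ good := by
      simp only [good, Finset.mem_filter, Finset.mem_univ, true_and]
      refine ⟨?_, ?_, ?_⟩
      · simp only [Finset.forall_mem_insert]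
        exact ⟨hXt, ht⟩
      · simp only [Finset.forall_mem_insert]
        exact ⟨⟨Or.inl le_rfl, fun T hT => (hc T hT).symm⟩, fun S hS => ⟨hc S hS, hlam S hS⟩⟩
      · rw [Finset.coe_insert]
        exact hind.insert hXs
    have := hmax _ hins
    rw [Finset.card_insert_of_notMem hXL] at this
    omega

end Uncrossing

variable [Fintype V] {f : Biset V → ℤ} {B : Finset V} {b : B → ℝ} {x : E → ℝ}

/-- At an extreme point with no tight box constraint, no nonzero vector is orthogonal to all tight
biset constraints and all degree constraints. -/
theorem eq_zero_of_orthogonal (hx : x ∈ Set.extremePoints ℝ (bisetPolytope ends f B b))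
    (hpos : ∀ e, 0 < x e) (hlt : ∀ e, x e < 1) {y : E → ℝ}
    (hy : ∀ S, TightAt ends f x S → ∑ e, cutVec ends S e * y e = 0)
    (hyB : ∀ v ∈ B, ∑ e, cutVec ends (Biset.single v) e * y e = 0) : y = 0 := by
  have hxP := hx.1
  have hlin : ∀ (S : Biset V) (ε : ℝ), ∑ e, cutVec ends S e * (x e + ε * y e) =
      ∑ e, cutVec ends S e * x e + ε * ∑ e, cutVec ends S e * y e := by
    intro S ε
    rw [Finset.mul_sum, ← Finset.sum_add_distrib]
    exact Finset.sum_congr rfl fun e _ => by ring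
  have hev : ∀ᶠ ε : ℝ in nhds 0, (fun e => x e + ε * y e) ∈ bisetPolytope ends f B b := by
    have h1 : ∀ᶠ ε : ℝ in nhds 0, ∀ S : Biset V,
        (f S : ℝ) ≤ ∑ e ∈ edgeCut ends S, (x e + ε * y e) := by
      rw [Filter.eventually_all]
      intro S
      have hS := hxP.1 S
      rw [sum_edgeCut] at hS
      rcases hS.eq_or_lt with h | h
      · refine Filter.Eventually.of_forall fun ε => ?_
        rw [sum_edgeCut ends S (fun e => x e + ε * y e), hlin, hy S h, mul_zero, add_zero]
        exact hS
      · have hcont : Continuous fun ε : ℝ => ∑ e, cutVec ends S e * (x e + ε * y e) := by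
          fun_prop
        have := hcont.tendsto 0
        simp only [zero_mul, add_zero] at this
        filter_upwards [this.eventually (lt_mem_nhds h)] with ε hε
        rw [sum_edgeCut ends S (fun e => x e + ε * y e)]
        exact hε.le
    have h2 : ∀ᶠ ε : ℝ in nhds 0, ∀ e, 0 ≤ x e + ε * y e ∧ x e + ε * y e ≤ 1 := by
      rw [Filter.eventually_all]
      intro e
      have hcont : Continuous fun ε : ℝ => x e + ε * y e := by fun_prop
      have := hcont.tendsto 0
      simp only [zero_mul, add_zero] at this
      filter_upwards [this.eventually (lt_mem_nhds (hpos e)),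
        this.eventually (gt_mem_nhds (hlt e))] with ε h3 h4
      exact ⟨h3.le, h4.le⟩
    filter_upwards [h1, h2] with ε h3 h4
    -- Degree sums do not change along y, so it is irrelevant which degree constraints are tight.
    refine ⟨h3, fun v => ?_, h4⟩
    have := hxP.2.1 v
    rw [sum_edgeCut] at this
    rw [sum_edgeCut ends _ (fun e => x e + ε * y e), hlin, hyB v v.2, mul_zero, add_zero]
    exact this
  have hneg : ∀ᶠ ε : ℝ in nhds 0, (fun e => x e + (-ε) * y e) ∈ bisetPolytope ends f B b := by
    have : Filter.Tendsto (fun ε : ℝ => -ε) (nhds 0) (nhds 0) := by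
      simpa using (continuous_neg (G := ℝ)).tendsto 0
    exact this.eventually hev
  obtain ⟨ε, ⟨hε1, hε2⟩, hε0⟩ :=
    (((hev.and hneg).filter_mono nhdsWithin_le_nhds).and
      (self_mem_nhdsWithin (a := (0 : ℝ)) (s := {0}ᶜ))).exists
  have hseg : x ∈ openSegment ℝ (fun e => x e + ε * y e) (fun e => x e + (-ε) * y e) := by
    refine ⟨1 / 2, 1 / 2, by norm_num, by norm_num, by norm_num, ?_⟩
    funext e
    simp only [Pi.add_apply, Pi.smul_apply, smul_eq_mul]
    ring
  have h := hx.2 hε1 hε2 hseg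
  funext e
  have he : x e + ε * y e = x e := congrFun h e
  have : ε * y e = 0 := by linarith
  exact (mul_eq_zero.1 this).resolve_left hε0

/-- The cut vectors of L and of the nodes in B span the whole space: a functional vanishing on them,
read as a vector, is a direction ruled out by `eq_zero_of_orthogonal`. -/
theorem card_le_of_extreme
    (hx : x ∈ Set.extremePoints ℝ (bisetPolytope ends f B b))
    (hpos : ∀ e, 0 < x e) (hlt : ∀ e, x e < 1) {L : Finset (Biset V)}
    (hL : ∀ S, TightAt ends f x S →
        cutVec ends S ∈ Submodule.span ℝ (cutVec ends '' (L : Set (Biset V)))) :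
    Fintype.card E ≤ L.card + B.card := by
  classical
  let G : Finset (E → ℝ) := L.image (cutVec ends) ∪ B.image (fun v => cutVec ends (Biset.single v))
  have hspan : Submodule.span ℝ (G : Set (E → ℝ)) = ⊤ := by
    by_contra hne
    obtain ⟨φ, hφ, hle⟩ := Submodule.exists_le_ker_of_lt_top _ (lt_top_iff_ne_top.2 hne)
    have hφ' : ∀ z : E → ℝ, φ z = ∑ e, z e * φ (Pi.single e 1) := by
      intro z
      conv_lhs => rw [LinearMap.pi_apply_eq_sum_univ φ z]
      refine Finset.sum_congr rfl fun e _ => ?_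
      rw [smul_eq_mul]
      congr 2
      funext j
      simp [Pi.single_apply, eq_comm]
    have hy : (fun e => φ (Pi.single e 1)) = (0 : E → ℝ) := by
      refine eq_zero_of_orthogonal ends hx hpos hlt (fun S hS => ?_) (fun v hv => ?_)
      · rw [← hφ']
        have hsub : Submodule.span ℝ (cutVec ends '' (L : Set (Biset V))) ≤
            Submodule.span ℝ (G : Set (E → ℝ)) := by
          apply Submodule.span_mono
          simp [G]
        exact hle (hsub (hL S hS))
      · rw [← hφ']
        apply hle
        apply Submodule.subset_span
        simp only [G, Finset.coe_union, Finset.coe_image]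
        exact Or.inr ⟨v, hv, rfl⟩
    apply hφ
    ext e
    simpa using congrFun hy e
  have h1 := finrank_span_finset_le_card (R := ℝ) G
  rw [Set.finrank, hspan, finrank_top, Module.finrank_fintype_fun_eq_card] at h1
  refine h1.trans ((Finset.card_union_le _ _).trans ?_)
  exact Nat.add_le_add Finset.card_image_le Finset.card_image_le

end Polyhedron

/-! ### Rooted forests of bisets, homes and entering nodes. -/

section Forest

variable {V : Type*} [Fintype V]

/-- The biset `(V, V)`. -/
def Biset.full : Biset V := ⟨Finset.univ, Finset.univ, Finset.Subset.refl _⟩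

theorem Biset.le_full (S : Biset V) : S ≤ Biset.full :=
  ⟨Finset.subset_univ _, Finset.subset_univ _⟩

/-- A laminar family of bisets with nonempty inner parts that contains `(V, V)`. -/
structure IsForest (F : Finset (Biset V)) : Prop where
  full_mem : Biset.full ∈ F
  laminar : ∀ S ∈ F, ∀ T ∈ F, Biset.Laminar S T
  nonempty : ∀ S ∈ F, S.innerPart.Nonempty

open Classical in
/-- The members of `F` whose least strict superset in `F` is `S`. -/
noncomputable def children (F : Finset (Biset V)) (S : Biset V) : Finset (Biset V) :=
  F.filter fun C => C < S ∧ ∀ Z ∈ F, C < Z → S ≤ Z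

namespace IsForest

variable {F : Finset (Biset V)}

theorem le_or_le (hF : IsForest F) {S T : Biset V} (hS : S ∈ F) (hT : T ∈ F) {v : V}
    (h₁ : v ∈ S.innerPart) (h₂ : v ∈ T.outerPart) : S ≤ T ∨ T ≤ S := by
  rcases hF.laminar S hS T hT with h | h | h
  · exact Or.inl h
  · exact Or.inr h
  · exact absurd h₂ (h.1 v h₁)

theorem mem_children {S C : Biset V} :
    C ∈ children F S ↔ C ∈ F ∧ C < S ∧ ∀ Z ∈ F, C < Z → S ≤ Z := by
  classical
  simp [children]

theorem mem_of_child {S C : Biset V} (h : C ∈ children F S) : C ∈ F := (mem_children.1 h).1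

theorem lt_of_child {S C : Biset V} (h : C ∈ children F S) : C < S := (mem_children.1 h).2.1

theorem child_ne_full {S C : Biset V} (h : C ∈ children F S) : C ≠ Biset.full := by
  rintro rfl
  exact (lt_of_child h).not_ge (Biset.le_full S)

theorem children_disjoint (hF : IsForest F) {S C C' : Biset V} (h : C ∈ children F S)
    (h' : C' ∈ children F S) (hne : C ≠ C') : Biset.StronglyDisjoint C C' := by
  rcases hF.laminar C (mem_of_child h) C' (mem_of_child h') with h1 | h1 | h1
  · exact absurd ((mem_children.1 h).2.2 C' (mem_of_child h') (lt_of_le_of_ne h1 hne))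
      (lt_of_child h').not_ge
  · exact absurd ((mem_children.1 h').2.2 C (mem_of_child h) (lt_of_le_of_ne h1 hne.symm))
      (lt_of_child h).not_ge
  · exact h1

theorem child_eq (hF : IsForest F) {S C C' : Biset V} (h : C ∈ children F S)
    (h' : C' ∈ children F S) {v : V} (hv : v ∈ C.innerPart) (hv' : v ∈ C'.outerPart) : C = C' := by
  by_contra hne
  exact (hF.children_disjoint h h' hne).1 v hv hv'

theorem exists_child_ge (hF : IsForest F) {S Z : Biset V} (hS : S ∈ F) (hZ : Z ∈ F)
    (hlt : Z < S) : ∃ C ∈ children F S, Z ≤ C := by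
  classical
  obtain ⟨C, hC, hmax⟩ := (F.filter fun W => Z ≤ W ∧ W < S).exists_maximal
    ⟨Z, Finset.mem_filter.2 ⟨hZ, le_rfl, hlt⟩⟩
  obtain ⟨hCF, hZC, hCS⟩ := Finset.mem_filter.1 hC
  refine ⟨C, mem_children.2 ⟨hCF, hCS, fun W hW hCW => ?_⟩, hZC⟩
  obtain ⟨v, hv⟩ := hF.nonempty C hCF
  rcases hF.le_or_le hS hW (hCS.le.1 hv) (W.subset (hCW.le.1 hv)) with h | h
  · exact h
  · by_contra hne
    have hWS : W < S := lt_of_le_not_ge h hne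
    exact hCW.not_ge (hmax (Finset.mem_filter.2 ⟨hW, hZC.trans hCW.le, hWS⟩) hCW.le)

theorem exists_parent (hF : IsForest F) {C : Biset V} (hC : C ∈ F) (hne : C ≠ Biset.full) :
    ∃ S ∈ F, C ∈ children F S := by
  classical
  obtain ⟨S, hS, hmin⟩ := (F.filter fun W => C < W).exists_minimal
    ⟨Biset.full, Finset.mem_filter.2 ⟨hF.full_mem, lt_of_le_of_ne C.le_full hne⟩⟩
  obtain ⟨hSF, hCS⟩ := Finset.mem_filter.1 hS
  refine ⟨S, hSF, mem_children.2 ⟨hC, hCS, fun W hW hCW => ?_⟩⟩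
  obtain ⟨v, hv⟩ := hF.nonempty C hC
  rcases hF.le_or_le hSF hW (hCS.le.1 hv) (W.subset (hCW.le.1 hv)) with h | h
  · exact h
  · exact hmin (Finset.mem_filter.2 ⟨hW, hCW⟩) h

theorem parent_unique {S T C : Biset V} (hS : S ∈ F) (hT : T ∈ F) (h : C ∈ children F S)
    (h' : C ∈ children F T) : S = T :=
  le_antisymm ((mem_children.1 h).2.2 T hT (lt_of_child h'))
    ((mem_children.1 h').2.2 S hS (lt_of_child h))

theorem sum_children (hF : IsForest F) {M : Type*} [AddCommMonoid M] (g : Biset V → M)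
    (hg : g Biset.full = 0) : ∑ S ∈ F, ∑ C ∈ children F S, g C = ∑ C ∈ F, g C := by
  classical
  have hcomm : ∑ S ∈ F, ∑ C ∈ children F S, g C =
      ∑ C ∈ F, ∑ _S ∈ F.filter (fun S => C ∈ children F S), g C := by
    refine Finset.sum_comm' fun S C => ?_
    simp only [Finset.mem_filter]
    exact ⟨fun h => ⟨h, mem_of_child h.2⟩, fun h => h.1⟩
  rw [hcomm]
  refine Finset.sum_congr rfl fun C hC => ?_
  by_cases hne : C = Biset.full
  · rw [hne, hg, Finset.sum_const_zero]
  · obtain ⟨S, hS, hCS⟩ := hF.exists_parent hC hne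
    have : F.filter (fun S => C ∈ children F S) = {S} := by
      ext T
      simp only [Finset.mem_filter, Finset.mem_singleton]
      exact ⟨fun h => parent_unique h.1 hS h.2 hCS, fun h => h ▸ ⟨hS, hCS⟩⟩
    rw [this, Finset.sum_singleton]

/-- The members of `F` without children. -/
noncomputable def leaves (F : Finset (Biset V)) : Finset (Biset V) :=
  F.filter fun S => (children F S).card = 0

/-- The members of `F` with at least two children. -/
noncomputable def branchings (F : Finset (Biset V)) : Finset (Biset V) :=
  F.filter fun S => 2 ≤ (children F S).card

/-- Every member but the root is a child exactly once. The truncated subtraction gives 0 rather than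
-1 at a leaf, so the leaves appear as the correction. -/
theorem sum_card_children_sub_one (hF : IsForest F) :
    ∑ S ∈ F, ((children F S).card - 1) + 1 = (leaves F).card := by
  classical
  have h1 := hF.sum_children (fun C => if C = Biset.full then 0 else 1) (by simp)
  have h2 : ∑ C ∈ F, (if C = Biset.full then 0 else 1) + 1 = F.card := by
    rw [← Finset.sum_erase_add _ _ hF.full_mem, if_pos rfl, add_zero,
      ← Finset.card_erase_add_one hF.full_mem, Finset.card_eq_sum_ones]
    congr 1
    exact Finset.sum_congr rfl fun C hC => if_neg (Finset.ne_of_mem_erase hC)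
  have h3 : ∀ S ∈ F, ∑ C ∈ children F S, (if C = Biset.full then 0 else 1) =
      (children F S).card := by
    intro S _
    rw [Finset.card_eq_sum_ones]
    exact Finset.sum_congr rfl fun C hC => if_neg (child_ne_full hC)
  rw [Finset.sum_congr rfl h3] at h1
  have h4 : ∑ S ∈ F, (children F S).card + (leaves F).card =
      ∑ S ∈ F, ((children F S).card - 1) + F.card := by
    rw [leaves, Finset.card_filter, Finset.card_eq_sum_ones F, ← Finset.sum_add_distrib,
      ← Finset.sum_add_distrib]
    refine Finset.sum_congr rfl fun S _ => ?_
    split_ifs with h <;> omega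
  omega

theorem card_branchings_lt (hF : IsForest F) : (branchings F).card + 1 ≤ (leaves F).card := by
  rw [← hF.sum_card_children_sub_one, branchings, Finset.card_filter]
  refine Nat.add_le_add_right (Finset.sum_le_sum fun S _ => ?_) 1
  split_ifs with h <;> omega

/-- `S` is the least member of the forest with `v` in its inner part. -/
def Home (F : Finset (Biset V)) (S : Biset V) (v : V) : Prop :=
  v ∈ S.innerPart ∧ ∀ C ∈ children F S, v ∉ C.innerPart

theorem home_unique (hF : IsForest F) {S T : Biset V} (hS : S ∈ F) (hT : T ∈ F) {v : V}
    (h : Home F S v) (h' : Home F T v) : S = T := by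
  by_contra hne
  rcases hF.le_or_le hS hT h.1 (T.subset h'.1) with h1 | h1
  · obtain ⟨C, hC, hle⟩ := hF.exists_child_ge hT hS (lt_of_le_of_ne h1 hne)
    exact h'.2 C hC (hle.1 h.1)
  · obtain ⟨C, hC, hle⟩ := hF.exists_child_ge hS hT (lt_of_le_of_ne h1 (Ne.symm hne))
    exact h.2 C hC (hle.1 h'.1)

open Classical in
/-- The members of the forest that are the least one around some node of `B`. -/
noncomputable def homes (F : Finset (Biset V)) (B : Finset V) : Finset (Biset V) :=
  F.filter fun S => ∃ v ∈ B, Home F S v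

theorem card_homes_le (hF : IsForest F) (B : Finset V) : (homes F B).card ≤ B.card := by
  classical
  have h : ∀ S ∈ homes F B, ∃ v ∈ B, Home F S v := fun S hS => (Finset.mem_filter.1 hS).2
  have : Nonempty V := ⟨(hF.nonempty _ hF.full_mem).choose⟩
  choose! g hg using h
  refine Finset.card_le_card_of_injOn g (fun S hS => (hg S hS).1) fun S hS T hT hST => ?_
  exact hF.home_unique (Finset.mem_filter.1 hS).1 (Finset.mem_filter.1 hT).1 (hg S hS).2
    (hST ▸ (hg T hT).2)

open Classical in
/-- The nodes of `B` that enter the boundary at `S`. -/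
noncomputable def entering (F : Finset (Biset V)) (B : Finset V) (S : Biset V) : Finset V :=
  B.filter fun v => (v ∈ S.outerPart ∧ v ∉ S.innerPart) ∧ ∀ C ∈ children F S, v ∉ C.outerPart

open Classical in
/-- The children of `S` with `v` in their boundary. -/
noncomputable def boundaryChildren (F : Finset (Biset V)) (S : Biset V) (v : V) :
    Finset (Biset V) :=
  (children F S).filter fun C => v ∈ C.outerPart ∧ v ∉ C.innerPart

/-- Going up, members with v in their boundary can only lead to another such member or to the unique
home of v. They thus form a tree below that home whose leaves are the places where v enters, and a
tree has one leaf more than its total excess branching. -/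
theorem sum_entering_single_le (hF : IsForest F) (v : V) (p : Biset V → Prop) [DecidablePred p]
    (hp : ∀ S ∈ F, p S → (v ∈ S.outerPart ∧ v ∉ S.innerPart) ∧ ∀ C ∈ children F S, v ∉ C.outerPart) :
    (F.filter p).card ≤ 1 + ∑ S ∈ F, ((boundaryChildren F S v).card - 1) := by
  classical
  let c : Biset V → ℕ := fun S => if v ∈ S.outerPart ∧ v ∉ S.innerPart then 1 else 0
  have h1 := hF.sum_children c (by simp [c, Biset.full])
  have h2 : ∀ S, ∑ C ∈ children F S, c C = (boundaryChildren F S v).card := by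
    intro S
    rw [boundaryChildren, Finset.card_filter]
  simp only [h2] at h1
  have hhome : (F.filter fun S => Home F S v).card ≤ 1 := by
    rw [Finset.card_le_one]
    intro S hS T hT
    exact hF.home_unique (Finset.mem_filter.1 hS).1 (Finset.mem_filter.1 hT).1
      (Finset.mem_filter.1 hS).2 (Finset.mem_filter.1 hT).2
  have hloc : ∀ S ∈ F, (if p S then 1 else 0) + (boundaryChildren F S v).card ≤
      c S + ((boundaryChildren F S v).card - 1) + (if Home F S v then 1 else 0) := by
    intro S hS
    by_cases hpS : p S
    · obtain ⟨h3, h4⟩ := hp S hS hpS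
      have h5 : (boundaryChildren F S v).card = 0 := by
        rw [Finset.card_eq_zero, boundaryChildren, Finset.filter_eq_empty_iff]
        exact fun C hC h => h4 C hC h.1
      simp only [c, if_pos hpS, if_pos h3, h5]
      omega
    · rw [if_neg hpS]
      by_cases hc : v ∈ S.outerPart ∧ v ∉ S.innerPart
      · simp only [c, if_pos hc]
        omega
      · rcases Nat.eq_zero_or_pos (boundaryChildren F S v).card with h0 | h0
        · omega
        · obtain ⟨C, hC⟩ := Finset.card_pos.1 h0
          obtain ⟨hCS, hvC, hvC'⟩ := Finset.mem_filter.1 hC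
          have hvS : v ∈ S.outerPart := (lt_of_child hCS).le.2 hvC
          have hH : Home F S v := by
            refine ⟨by tauto, fun C' hC' hv' => ?_⟩
            exact hvC' (hF.child_eq hC' hCS hv' hvC ▸ hv')
          rw [if_pos hH]
          omega
  have hsum := Finset.sum_le_sum hloc
  simp only [Finset.sum_add_distrib] at hsum
  rw [Finset.card_filter] at hhome ⊢
  have hc : ∑ S ∈ F, c S = ∑ S ∈ F, (boundaryChildren F S v).card := h1.symm
  omega

/-- Sum the single-node bound over B. At a member with d ≥ 1 children the excess branching of all
nodes is at most γ(d - 1), and these d - 1 add up to the number of leaves minus one. -/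
theorem sum_entering_le (hF : IsForest F) (B : Finset V) {γ : ℕ}
    (hγ : ∀ S ∈ F, ∀ U : Finset V, (∀ v ∈ U, v ∈ S.outerPart ∧ v ∉ S.innerPart) → U.card ≤ γ) :
    ∑ S ∈ F, (entering F B S).card + γ ≤ B.card + γ * (leaves F).card := by
  classical
  have h1 : ∑ S ∈ F, (entering F B S).card = ∑ v ∈ B, (F.filter fun S =>
      (v ∈ S.outerPart ∧ v ∉ S.innerPart) ∧ ∀ C ∈ children F S, v ∉ C.outerPart).card := by
    simp only [entering, Finset.card_filter]
    exact Finset.sum_comm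
  have h2 : ∑ v ∈ B, (F.filter fun S =>
      (v ∈ S.outerPart ∧ v ∉ S.innerPart) ∧ ∀ C ∈ children F S, v ∉ C.outerPart).card ≤
      ∑ v ∈ B, (1 + ∑ S ∈ F, ((boundaryChildren F S v).card - 1)) :=
    Finset.sum_le_sum fun v _ => hF.sum_entering_single_le v _ fun S _ h => h
  rw [Finset.sum_add_distrib, Finset.sum_comm, ← Finset.card_eq_sum_ones] at h2
  have h3 : ∀ S ∈ F, ∑ v ∈ B, ((boundaryChildren F S v).card - 1) ≤
      γ * ((children F S).card - 1) := by
    intro S hS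
    have h4 : ∑ v ∈ B, (boundaryChildren F S v).card ≤ γ * (children F S).card := by
      simp only [boundaryChildren, Finset.card_filter]
      rw [Finset.sum_comm, mul_comm, ← smul_eq_mul, ← Finset.sum_const]
      refine Finset.sum_le_sum fun C hC => ?_
      rw [← Finset.card_filter]
      exact hγ C (mem_of_child hC) _ fun v hv => (Finset.mem_filter.1 hv).2
    rcases Nat.eq_zero_or_pos (children F S).card with h0 | h0
    · have : ∀ v, (boundaryChildren F S v).card = 0 := fun v =>
        Nat.eq_zero_of_le_zero (h0 ▸ Finset.card_filter_le _ _)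
      simp [this]
    · refine Nat.le_of_mul_le_mul_right ?_ h0
      rw [Finset.sum_mul]
      calc ∑ v ∈ B, ((boundaryChildren F S v).card - 1) * (children F S).card
          -- A node lies in the boundary of c ≤ d children, and then (c - 1)d ≤ c(d - 1).
          ≤ ∑ v ∈ B, (boundaryChildren F S v).card * ((children F S).card - 1) := by
            refine Finset.sum_le_sum fun v _ => ?_
            have hle : (boundaryChildren F S v).card ≤ (children F S).card :=
              Finset.card_filter_le _ _
            rw [Nat.sub_mul, Nat.mul_sub]
            omega
        _ ≤ γ * (children F S).card * ((children F S).card - 1) := by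
            rw [← Finset.sum_mul]
            exact Nat.mul_le_mul_right _ h4
        _ = γ * ((children F S).card - 1) * (children F S).card := by ring
  have h5 := Finset.sum_le_sum h3
  rw [← Finset.mul_sum] at h5
  have h6 := hF.sum_card_children_sub_one
  rw [← h6, Nat.mul_add, h1]
  omega

end IsForest

end Forest

/-! ### Directed copies of edges and where they start and stop. -/

section HalfEdges

variable {V E : Type*}

/-- The same edge, traversed in the other direction. -/
def rev (h : E × Bool) : E × Bool := (h.1, !h.2)

@[simp] theorem rev_rev (h : E × Bool) : rev (rev h) = h := by simp [rev]

@[simp] theorem rev_fst (h : E × Bool) : (rev h).1 = h.1 := rfl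

/-- The starting node of a directed copy of an edge. -/
noncomputable def tail (ends : E → Sym2 V) (h : E × Bool) : V :=
  if h.2 then (Quot.out (ends h.1)).1 else (Quot.out (ends h.1)).2

/-- The directed edge `h` leaves `S`. -/
def Leaves (ends : E → Sym2 V) (h : E × Bool) (S : Biset V) : Prop :=
  tail ends h ∈ S.innerPart ∧ tail ends (rev h) ∉ S.outerPart

variable (ends : E → Sym2 V)

theorem ends_eq_tail (e : E) : ends e = s(tail ends (e, true), tail ends (e, false)) := by
  simp only [tail]
  exact (Quot.out_eq (ends e)).symm

theorem ends_eq_tail_rev (h : E × Bool) : ends h.1 = s(tail ends h, tail ends (rev h)) := by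
  obtain ⟨e, i⟩ := h
  cases i
  · rw [ends_eq_tail ends e, Sym2.eq_swap]
    rfl
  · exact ends_eq_tail ends e

open Classical in
theorem sum_leaves [Fintype E] (S : Biset V) (x : E → ℝ) :
    ∑ h : E × Bool, (if Leaves ends h S then x h.1 else 0) = ∑ e, cutVec ends S e * x e := by
  rw [Fintype.sum_prod_type]
  refine Finset.sum_congr rfl fun e _ => ?_
  rw [Fintype.sum_bool, cutVec_eq ends (ends_eq_tail ends e)]
  simp only [Leaves, rev, Bool.not_true, Bool.not_false]
  split_ifs <;> simp_all
  ring

/-- Reversal is an involution without fixed points. -/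
theorem even_card_of_rev {A : Finset (E × Bool)} (hA : ∀ h ∈ A, rev h ∈ A) : 2 ∣ A.card := by
  rw [← ZMod.natCast_eq_zero_iff, Finset.cast_card]
  refine Finset.sum_involution (fun h _ => rev h) (fun h _ => by decide) (fun h _ _ heq => ?_)
    hA (fun h _ => rev_rev h)
  have := congrArg Prod.snd heq
  simp [rev] at this

open Classical in
theorem sum_filter_of_card [Fintype E] {M : Type*} [AddCommMonoid M]
    {F : Finset (Biset V)} {P : E × Bool → Biset V → Prop} {A : E × Bool → Prop}
    (hP : ∀ h, (F.filter (P h)).card = if A h then 1 else 0) (Q : E × Bool → Prop)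
    (w : E × Bool → M) :
    ∑ S ∈ F, ∑ h with P h S ∧ Q h, w h = ∑ h with A h ∧ Q h, w h := by
  simp only [Finset.sum_filter]
  rw [Finset.sum_comm]
  refine Finset.sum_congr rfl fun h _ => ?_
  by_cases hQ : Q h
  · simp only [hQ, and_true]
    rw [← Finset.sum_filter, Finset.sum_const, hP h]
    split_ifs <;> simp
  · simp [hQ]

open Classical in
theorem card_edgeCut_le [Fintype E] (v : V) :
    (edgeCut ends (Biset.single v)).card ≤
      (Finset.univ.filter fun h : E × Bool => tail ends h = v).card := by
  have hsub : edgeCut ends (Biset.single v) ⊆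
      (Finset.univ.filter fun h : E × Bool => tail ends h = v).image Prod.fst := by
    intro e he
    have hc : EdgeCovers ends e (Biset.single v) := by simpa [edgeCut] using he
    rw [edgeCovers_mk ends (ends_eq_tail ends e)] at hc
    simp only [Biset.single, Finset.mem_singleton] at hc
    rcases hc with hc | hc
    · exact Finset.mem_image.2 ⟨(e, true), by simpa using hc.1, rfl⟩
    · exact Finset.mem_image.2 ⟨(e, false), by simpa using hc.1, rfl⟩
  exact (Finset.card_le_card hsub).trans Finset.card_image_le

open Classical in
theorem sum_degree_le [Fintype E] (B : Finset V) :
    ∑ v ∈ B, (edgeCut ends (Biset.single v)).card ≤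
      (Finset.univ.filter fun h : E × Bool => tail ends h ∈ B).card := by
  rw [Finset.card_eq_sum_card_fiberwise (s := Finset.univ.filter fun h => tail ends h ∈ B)
    (f := tail ends) (t := B) (fun h hh => (Finset.mem_filter.1 hh).2)]
  refine Finset.sum_le_sum fun v hv => (card_edgeCut_le ends v).trans (Finset.card_le_card ?_)
  intro h hh
  have : tail ends h = v := (Finset.mem_filter.1 hh).2
  simp [this, hv]

variable [Fintype V] (F : Finset (Biset V))

/-- `S` is the least member of `F` that `h` leaves. -/
def IsStart (h : E × Bool) (S : Biset V) : Prop :=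
  Leaves ends h S ∧ ∀ C ∈ children F S, ¬ Leaves ends h C

/-- `h` leaves a child of `S`, but not `S`. -/
def IsStop (h : E × Bool) (S : Biset V) : Prop :=
  ¬ Leaves ends h S ∧ ∃ C ∈ children F S, Leaves ends h C

/-- `h` leaves some member of `F`. -/
def Active (h : E × Bool) : Prop := ∃ S ∈ F, Leaves ends h S

variable {ends F}

namespace IsForest

theorem not_leaves_full (h : E × Bool) : ¬ Leaves ends h Biset.full :=
  fun hl => hl.2 (Finset.mem_univ _)

theorem leaves_child_eq (hF : IsForest F) {h : E × Bool} {S C C' : Biset V}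
    (hC : C ∈ children F S) (hC' : C' ∈ children F S) (hl : Leaves ends h C)
    (hl' : Leaves ends h C') : C = C' :=
  hF.child_eq hC hC' hl.1 (C'.subset hl'.1)

theorem isStart_home {h : E × Bool} {S : Biset V} (hs : IsStart ends F h S) :
    Home F S (tail ends h) :=
  ⟨hs.1.1, fun C hC hv => hs.2 C hC ⟨hv, fun ho => hs.1.2 ((lt_of_child hC).le.2 ho)⟩⟩

theorem exists_isStart {h : E × Bool} (ha : Active ends F h) :
    ∃ S ∈ F, IsStart ends F h S := by
  classical
  obtain ⟨T, hT, hl⟩ := ha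
  obtain ⟨S, hS, hmin⟩ := (F.filter fun W => Leaves ends h W).exists_minimal
    ⟨T, Finset.mem_filter.2 ⟨hT, hl⟩⟩
  obtain ⟨hSF, hSl⟩ := Finset.mem_filter.1 hS
  refine ⟨S, hSF, hSl, fun C hC hCl => ?_⟩
  exact (lt_of_child hC).not_ge
    (hmin (Finset.mem_filter.2 ⟨mem_of_child hC, hCl⟩) (lt_of_child hC).le)

open Classical in
theorem card_isStart (hF : IsForest F) (h : E × Bool) :
    (F.filter (IsStart ends F h)).card = if Active ends F h then 1 else 0 := by
  split_ifs with ha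
  · obtain ⟨S, hS, hs⟩ := exists_isStart ha
    rw [Finset.card_eq_one]
    refine ⟨S, ?_⟩
    ext T
    simp only [Finset.mem_filter, Finset.mem_singleton]
    exact ⟨fun hT => hF.home_unique hT.1 hS (isStart_home hT.2) (isStart_home hs),
      fun hT => hT ▸ ⟨hS, hs⟩⟩
  · rw [Finset.card_eq_zero, Finset.filter_eq_empty_iff]
    exact fun S hS hs => ha ⟨S, hS, hs.1⟩

open Classical in
/-- Leaving `S` or stopping at `S` is balanced by starting at `S` or leaving a child of `S`. -/
theorem leaves_add_isStop (hF : IsForest F) (h : E × Bool) (S : Biset V) {M : Type*}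
    [AddCommMonoid M] (w : M) :
    (if Leaves ends h S then w else 0) + (if IsStop ends F h S then w else 0) =
      (if IsStart ends F h S then w else 0) +
        ∑ C ∈ children F S, (if Leaves ends h C then w else 0) := by
  by_cases hC : ∃ C ∈ children F S, Leaves ends h C
  · obtain ⟨C, hCS, hCl⟩ := hC
    have h1 : ∑ C ∈ children F S, (if Leaves ends h C then w else 0) = w := by
      rw [Finset.sum_eq_single_of_mem C hCS, if_pos hCl]
      intro C' hC' hne
      exact if_neg fun hl => hne (hF.leaves_child_eq hC' hCS hl hCl)
    have h2 : ¬ IsStart ends F h S := fun hs => hs.2 C hCS hCl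
    rw [h1, if_neg h2]
    by_cases hl : Leaves ends h S
    · rw [if_pos hl, if_neg fun hs => hs.1 hl, add_comm]
    · rw [if_neg hl, if_pos ⟨hl, C, hCS, hCl⟩]
  · have h1 : ∑ C ∈ children F S, (if Leaves ends h C then w else 0) = 0 :=
      Finset.sum_eq_zero fun C hCS => if_neg fun hl => hC ⟨C, hCS, hl⟩
    have h2 : ¬ IsStop ends F h S := fun hs => hC hs.2
    rw [h1, if_neg h2]
    congr 1
    refine if_congr ⟨fun hl => ⟨hl, fun C hCS hCl => hC ⟨C, hCS, hCl⟩⟩, fun hs => hs.1⟩ rfl rfl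

-- Summing the balance `leaves_add_isStop` over F cancels all leavings, because nothing leaves the
-- root; stops are therefore as many as starts.
open Classical in
theorem card_isStop (hF : IsForest F) (h : E × Bool) :
    (F.filter (IsStop ends F h)).card = if Active ends F h then 1 else 0 := by
  rw [← hF.card_isStart h, Finset.card_filter, Finset.card_filter]
  have h1 := Finset.sum_congr rfl fun S (_ : S ∈ F) => hF.leaves_add_isStop (ends := ends) h S 1
  simp only [Finset.sum_add_distrib] at h1
  rw [hF.sum_children (fun C => if Leaves ends h C then 1 else 0)
    (if_neg (not_leaves_full h))] at h1
  omega

/-- Any member left by the reverse contains the head but not the tail, so it lies strictly below S,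
under a child different from the one `h` leaves. Strong disjointness of the two children makes the
reverse leave that child too. -/
theorem isStop_rev (hF : IsForest F) {h : E × Bool} {S : Biset V} (hS : S ∈ F)
    (hs : IsStop ends F h S) (ha : Active ends F (rev h)) : IsStop ends F (rev h) S := by
  obtain ⟨hnl, C, hC, hCl⟩ := hs
  obtain ⟨T, hT, hTl⟩ := ha
  have htS : tail ends h ∈ S.innerPart := (lt_of_child hC).le.1 hCl.1
  have hhS : tail ends (rev h) ∈ S.outerPart := by
    by_contra hn
    exact hnl ⟨htS, hn⟩
  have hTl2 : tail ends h ∉ T.outerPart := by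
    have := hTl.2
    rwa [rev_rev] at this
  have hlt : T < S := by
    rcases hF.le_or_le hT hS hTl.1 hhS with h1 | h1
    · refine lt_of_le_of_ne h1 ?_
      rintro rfl
      exact hTl2 (T.subset htS)
    · exact absurd (T.subset (h1.1 htS)) hTl2
  obtain ⟨C', hC', hle⟩ := hF.exists_child_ge hS hT hlt
  have hne : C ≠ C' := by
    rintro rfl
    exact hCl.2 (C.subset (hle.1 hTl.1))
  refine ⟨fun hl => hl.2 ?_, C', hC', hle.1 hTl.1, ?_⟩
  · rw [rev_rev]
    exact S.subset htS
  · rw [rev_rev]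
    exact (hF.children_disjoint hC hC' hne).1 _ hCl.1

end IsForest

variable (ends F)
variable [Fintype E]

open Classical in
/-- The directed edges for which `S` is the least member of `F` that they leave. -/
noncomputable def starts (S : Biset V) : Finset (E × Bool) :=
  Finset.univ.filter fun h => IsStart ends F h S

open Classical in
/-- The directed edges that stop at `S` and whose reverse leaves no member of `F`. -/
noncomputable def singleStops (S : Biset V) : Finset (E × Bool) :=
  Finset.univ.filter fun h => IsStop ends F h S ∧ ¬ Active ends F (rev h)

open Classical in
/-- The directed edges that stop at `S` together with their reverse. -/
noncomputable def doubleStops (S : Biset V) : Finset (E × Bool) :=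
  Finset.univ.filter fun h => IsStop ends F h S ∧ Active ends F (rev h)

open Classical in
/-- The directed edges that leave no member of `F` in either direction. -/
noncomputable def idle : Finset (E × Bool) :=
  Finset.univ.filter fun h => ¬ Active ends F h ∧ ¬ Active ends F (rev h)

variable {ends F}

theorem mem_starts {h : E × Bool} {S : Biset V} :
    h ∈ starts ends F S ↔ IsStart ends F h S := by
  classical
  simp [starts]

theorem mem_singleStops {h : E × Bool} {S : Biset V} :
    h ∈ singleStops ends F S ↔ IsStop ends F h S ∧ ¬ Active ends F (rev h) := by
  classical
  simp [singleStops]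

theorem mem_doubleStops {h : E × Bool} {S : Biset V} :
    h ∈ doubleStops ends F S ↔ IsStop ends F h S ∧ Active ends F (rev h) := by
  classical
  simp [doubleStops]

theorem mem_idle {V E : Type*} [Fintype E] {ends : E → Sym2 V} {F : Finset (Biset V)}
    {h : E × Bool} :
    h ∈ idle ends F ↔ ¬ Active ends F h ∧ ¬ Active ends F (rev h) := by
  classical
  simp [idle]

namespace IsForest

open Classical in
theorem sum_starts (hF : IsForest F) {M : Type*} [AddCommMonoid M] (w : E × Bool → M) :
    ∑ S ∈ F, ∑ h ∈ starts ends F S, w h = ∑ h with Active ends F h, w h := by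
  have := sum_filter_of_card (P := IsStart ends F) (A := Active ends F) hF.card_isStart
    (fun _ => True) w
  simpa [starts] using this

open Classical in
theorem sum_singleStops (hF : IsForest F) {M : Type*} [AddCommMonoid M] (w : E × Bool → M) :
    ∑ S ∈ F, ∑ h ∈ singleStops ends F S, w h =
      ∑ h with Active ends F h ∧ ¬ Active ends F (rev h), w h := by
  have := sum_filter_of_card (P := IsStop ends F) (A := Active ends F) hF.card_isStop
    (fun h => ¬ Active ends F (rev h)) w
  convert this using 3
  ext h
  simp [mem_singleStops]

open Classical in
theorem sum_doubleStops (hF : IsForest F) {M : Type*} [AddCommMonoid M] (w : E × Bool → M) :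
    ∑ S ∈ F, ∑ h ∈ doubleStops ends F S, w h =
      ∑ h with Active ends F h ∧ Active ends F (rev h), w h :=
  sum_filter_of_card (P := IsStop ends F) (A := Active ends F) hF.card_isStop
    (fun h => Active ends F (rev h)) w

theorem sum_starts_eq_sum_stops (hF : IsForest F) {M : Type*} [AddCommMonoid M]
    (w : E × Bool → M) :
    ∑ S ∈ F, ∑ h ∈ starts ends F S, w h =
      ∑ S ∈ F, (∑ h ∈ singleStops ends F S, w h + ∑ h ∈ doubleStops ends F S, w h) := by
  classical
  rw [Finset.sum_add_distrib, hF.sum_starts, hF.sum_singleStops, hF.sum_doubleStops, add_comm,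
    ← Finset.sum_filter_add_sum_filter_not (Finset.univ.filter fun h => Active ends F h)
      (fun h => Active ends F (rev h)), Finset.filter_filter, Finset.filter_filter]

/-- Every directed edge starts somewhere, or is the reverse of one that stops, or is idle. -/
theorem sum_halfEdges (hF : IsForest F) {M : Type*} [AddCommMonoid M] (w : E × Bool → M) :
    ∑ h, w h = ∑ S ∈ F, (∑ h ∈ starts ends F S, w h + ∑ h ∈ singleStops ends F S, w (rev h)) +
      ∑ h ∈ idle ends F, w h := by
  classical
  rw [Finset.sum_add_distrib, hF.sum_starts, hF.sum_singleStops, add_assoc,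
    ← Finset.sum_filter_add_sum_filter_not Finset.univ (fun h => Active ends F h)]
  congr 1
  rw [← Finset.sum_filter_add_sum_filter_not (Finset.univ.filter fun h => ¬ Active ends F h)
      (fun h => Active ends F (rev h)), Finset.filter_filter, Finset.filter_filter]
  congr 1
  refine Finset.sum_bij' (fun h _ => rev h) (fun h _ => rev h) ?_ ?_ ?_ ?_ ?_ <;>
    simp +contextual

theorem two_dvd_card_doubleStops (hF : IsForest F) {S : Biset V} (hS : S ∈ F) :
    2 ∣ (doubleStops ends F S).card := by
  refine even_card_of_rev fun h hh => ?_
  rw [mem_doubleStops] at hh ⊢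
  refine ⟨hF.isStop_rev hS hh.1 hh.2, ?_⟩
  rw [rev_rev]
  obtain ⟨C, hC, hl⟩ := hh.1.2
  exact ⟨C, mem_of_child hC, hl⟩

theorem two_dvd_card_idle {V E : Type*} [Fintype E] {ends : E → Sym2 V}
    {F : Finset (Biset V)} : 2 ∣ (idle ends F).card := by
  refine even_card_of_rev fun h hh => ?_
  rw [mem_idle] at hh ⊢
  rw [rev_rev]
  exact hh.symm

theorem singleStops_eq_empty {S : Biset V} (h0 : (children F S).card = 0) :
    singleStops ends F S = ∅ := by
  rw [Finset.card_eq_zero] at h0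
  refine Finset.eq_empty_of_forall_notMem fun h hh => ?_
  obtain ⟨C, hC, -⟩ := (mem_singleStops.1 hh).1.2
  simp [h0] at hC

/-- A copy and its reverse stopping at S leave different children of S. -/
theorem doubleStops_eq_empty (hF : IsForest F) {S : Biset V} (hS : S ∈ F)
    (h1 : (children F S).card ≤ 1) : doubleStops ends F S = ∅ := by
  refine Finset.eq_empty_of_forall_notMem fun h hh => ?_
  obtain ⟨hs, ha⟩ := mem_doubleStops.1 hh
  obtain ⟨-, C', hC', hl'⟩ := hF.isStop_rev hS hs ha
  obtain ⟨-, C, hC, hl⟩ := hs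
  obtain rfl := Finset.card_le_one.1 h1 C hC C' hC'
  exact hl.2 (C.subset hl'.1)

/-- Flow conservation at S. It is the source both of integrality and, for unit vectors x, of linear
relations among cuts. -/
theorem cutVec_balance (hF : IsForest F) (S : Biset V) (x : E → ℝ) :
    ∑ e, cutVec ends S e * x e +
      (∑ h ∈ singleStops ends F S, x h.1 + ∑ h ∈ doubleStops ends F S, x h.1) =
    ∑ h ∈ starts ends F S, x h.1 +
      ∑ C ∈ children F S, ∑ e, cutVec ends C e * x e := by
  classical
  have h1 := Finset.sum_congr rfl fun h (_ : h ∈ (Finset.univ : Finset (E × Bool))) =>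
    hF.leaves_add_isStop (ends := ends) h S (x h.1)
  simp only [Finset.sum_add_distrib, sum_leaves] at h1
  rw [Finset.sum_comm] at h1
  simp only [sum_leaves] at h1
  rw [starts, Finset.sum_filter, ← h1]
  congr 1
  rw [← Finset.sum_filter, ← Finset.sum_filter_add_sum_filter_not
    (Finset.univ.filter fun h => IsStop ends F h S) (fun h => Active ends F (rev h)),
    Finset.filter_filter, Finset.filter_filter, add_comm]
  rfl

/-- The head itself enters: it is in the outer part of S since the copy stops there, outside the
only child, and not in the inner part, as otherwise S would be its home. -/
theorem entering_nonempty {S : Biset V} {B : Finset V}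
    (h1 : (children F S).card = 1) (hB : ∀ v ∈ B, ¬ Home F S v) {h : E × Bool}
    (hh : h ∈ singleStops ends F S) (hv : tail ends (rev h) ∈ B) :
    1 ≤ (entering F B S).card := by
  classical
  obtain ⟨⟨hnl, C, hC, hl⟩, -⟩ := mem_singleStops.1 hh
  refine Finset.card_pos.2 ⟨tail ends (rev h), Finset.mem_filter.2 ⟨hv, ⟨?_, ?_⟩, ?_⟩⟩
  · by_contra hn
    exact hnl ⟨(lt_of_child hC).le.1 hl.1, hn⟩
  · intro hin
    refine hB _ hv ⟨hin, fun C' hC' hin' => ?_⟩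
    obtain rfl := Finset.card_le_one.1 h1.le C hC C' hC'
    exact hl.2 (C.subset hin')
  · intro C' hC'
    obtain rfl := Finset.card_le_one.1 h1.le C hC C' hC'
    exact hl.2

end IsForest

end HalfEdges

/-! ### Tight forests and the degree bound for weights below 1/α. -/

section Counting

/-- A set of directed edges of weight below `1 / α` and total weight at least one is large. -/
theorem add_one_le_card_of_one_le_sum {E : Type*} {x : E → ℝ} {α : ℤ} (hα : 0 < α)
    (hlt : ∀ e, x e < 1 / (α : ℝ))
    {A : Finset (E × Bool)} (hA : 1 ≤ ∑ h ∈ A, x h.1) : (α : ℝ) + 1 ≤ A.card := by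
  have hα' : (0 : ℝ) < α := by exact_mod_cast hα
  have hne : A.Nonempty := by
    rw [Finset.nonempty_iff_ne_empty]
    rintro rfl
    simp at hA
    linarith
  have h1 : ∑ h ∈ A, x h.1 < ∑ _h ∈ A, 1 / (α : ℝ) :=
    Finset.sum_lt_sum_of_nonempty hne fun h _ => hlt h.1
  rw [Finset.sum_const, nsmul_eq_mul, mul_one_div] at h1
  have h2 : (α : ℝ) < A.card := by
    have := hA.trans_lt h1
    rwa [lt_div_iff₀ hα', one_mul] at this
  have h3 : α < (A.card : ℤ) := by exact_mod_cast h2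
  have h4 : α + 1 ≤ (A.card : ℤ) := h3
  exact_mod_cast h4

variable {V E : Type*} [Fintype V] [Fintype E]

/-- A forest of bisets whose cuts have positive integral weight, with boundaries of size at most
`γ`, in which an edge starts or stops at every member, and that together with the nodes in `B` is
large enough to determine all edges. -/
structure IsTightForest (ends : E → Sym2 V) (F : Finset (Biset V)) (B : Finset V) (x : E → ℝ)
    (γ : ℕ) : Prop where
  forest : IsForest F
  pos : ∀ e, 0 < x e
  integral : ∀ S ∈ F, ∃ k : ℤ, ∑ e, cutVec ends S e * x e = k
  one_le : ∀ S ∈ F, S ≠ Biset.full → 1 ≤ ∑ e, cutVec ends S e * x e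
  boundary_le : ∀ S ∈ F, ∀ U : Finset V,
    (∀ v ∈ U, v ∈ S.outerPart ∧ v ∉ S.innerPart) → U.card ≤ γ
  moves : ∀ S ∈ F, (starts ends F S).Nonempty ∨ (singleStops ends F S).Nonempty ∨
    (doubleStops ends F S).Nonempty
  children_full : (children F Biset.full).Nonempty
  card_le : Fintype.card E + 1 ≤ F.card + B.card

open Classical in
/-- The directed edges starting at `S` from a node of `B`. -/
noncomputable def startsFrom (ends : E → Sym2 V) (F : Finset (Biset V)) (B : Finset V)
    (S : Biset V) : Finset (E × Bool) :=
  (starts ends F S).filter fun h => tail ends h ∈ B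

open Classical in
/-- The directed edges stopping alone at `S` and pointing to a node of `B`. -/
noncomputable def stopsTo (ends : E → Sym2 V) (F : Finset (Biset V)) (B : Finset V)
    (S : Biset V) : Finset (E × Bool) :=
  (singleStops ends F S).filter fun h => tail ends (rev h) ∈ B

variable {ends : E → Sym2 V} {F : Finset (Biset V)} {B : Finset V} {x : E → ℝ} {γ : ℕ}

theorem card_startsFrom_le (S : Biset V) :
    (startsFrom ends F B S).card ≤ (starts ends F S).card := by
  classical exact Finset.card_filter_le _ _

theorem card_stopsTo_le (S : Biset V) :
    (stopsTo ends F B S).card ≤ (singleStops ends F S).card := by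
  classical exact Finset.card_filter_le _ _

theorem mem_homes {S : Biset V} :
    S ∈ IsForest.homes F B ↔ S ∈ F ∧ ∃ v ∈ B, IsForest.Home F S v := by
  classical
  simp [IsForest.homes]

theorem startsFrom_eq_empty {S : Biset V} (hS : S ∈ F) (hh : S ∉ IsForest.homes F B) :
    startsFrom ends F B S = ∅ := by
  classical
  refine Finset.filter_eq_empty_iff.2 fun h hs hB => hh (mem_homes.2 ⟨hS, _, hB, ?_⟩)
  exact IsForest.isStart_home (mem_starts.1 hs)

theorem one_le_entering_of_stopsTo {S : Biset V} (hS : S ∈ F)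
    (h1 : (children F S).card = 1) (hh : S ∉ IsForest.homes F B)
    (ha : 1 ≤ (stopsTo ends F B S).card) : 1 ≤ (IsForest.entering F B S).card := by
  classical
  obtain ⟨h, hmem⟩ := Finset.card_pos.1 ha
  obtain ⟨hs, hB⟩ := Finset.mem_filter.1 hmem
  exact IsForest.entering_nonempty h1 (fun v hv hH => hh (mem_homes.2 ⟨hS, v, hv, hH⟩)) hs hB

namespace IsTightForest

theorem sum_pos (h : IsTightForest ends F B x γ) {A : Finset (E × Bool)} (hA : A.Nonempty) :
    0 < ∑ a ∈ A, x a.1 := Finset.sum_pos (fun a _ => h.pos a.1) hA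

theorem integral_sum_children (h : IsTightForest ends F B x γ) (S : Biset V) :
    ∃ k : ℤ, ∑ C ∈ children F S, ∑ e, cutVec ends C e * x e = k := by
  have h1 : ∀ C ∈ children F S, ∃ k : ℤ, ∑ e, cutVec ends C e * x e = k :=
    fun C hC => h.integral C (IsForest.mem_of_child hC)
  choose! k hk using h1
  exact ⟨∑ C ∈ children F S, k C, by
    rw [Finset.sum_congr rfl hk]
    push_cast
    rfl⟩

/-- The weight starting at `S` minus the weight stopping at `S` is an integer. -/
theorem integral_balance (h : IsTightForest ends F B x γ) {S : Biset V} (hS : S ∈ F) :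
    ∃ k : ℤ, ∑ a ∈ starts ends F S, x a.1 - (∑ a ∈ singleStops ends F S, x a.1 +
      ∑ a ∈ doubleStops ends F S, x a.1) = k := by
  obtain ⟨k₁, h₁⟩ := h.integral S hS
  obtain ⟨k₂, h₂⟩ := h.integral_sum_children S
  have hb := h.forest.cutVec_balance (ends := ends) S x
  exact ⟨k₁ - k₂, by push_cast; linarith⟩

theorem one_le_of_integral {r : ℝ} (hr : 0 < r) (hk : ∃ k : ℤ, r = k) : 1 ≤ r := by
  obtain ⟨k, rfl⟩ := hk
  have : 0 < k := by exact_mod_cast hr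
  exact_mod_cast this

theorem one_le_sum_starts_of_leaf (h : IsTightForest ends F B x γ) {S : Biset V} (hS : S ∈ F)
    (hne : S ≠ Biset.full) (h0 : (children F S).card = 0) :
    1 ≤ ∑ a ∈ starts ends F S, x a.1 := by
  have hb := h.forest.cutVec_balance (ends := ends) S x
  rw [IsForest.singleStops_eq_empty h0, h.forest.doubleStops_eq_empty hS (by omega),
    Finset.card_eq_zero.1 h0] at hb
  simp only [Finset.sum_empty, add_zero] at hb
  rw [← hb]
  exact h.one_le S hS hne

theorem sum_degree_le (h : IsTightForest ends F B x γ) {D : ℝ}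
    (hD : ∀ v ∈ B, D ≤ (edgeCut ends (Biset.single v)).card) :
    D * B.card ≤ ∑ S ∈ F, (((startsFrom ends F B S).card : ℝ) + (stopsTo ends F B S).card) +
      (idle ends F).card := by
  classical
  have h1 : D * B.card ≤ ((∑ v ∈ B, (edgeCut ends (Biset.single v)).card : ℕ) : ℝ) := by
    push_cast
    rw [mul_comm, ← nsmul_eq_mul, ← Finset.sum_const]
    exact Finset.sum_le_sum hD
  refine h1.trans ?_
  have h2 := _root_.sum_degree_le ends B
  have h3 := h.forest.sum_halfEdges (ends := ends) fun a => if tail ends a ∈ B then 1 else 0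
  rw [← Finset.card_filter] at h3
  have h4 : ∑ a ∈ idle ends F, (if tail ends a ∈ B then 1 else 0) ≤ (idle ends F).card := by
    rw [← Finset.card_filter]
    exact Finset.card_filter_le _ _
  have h5 : ∑ S ∈ F, (∑ a ∈ starts ends F S, (if tail ends a ∈ B then 1 else 0) +
      ∑ a ∈ singleStops ends F S, (if tail ends (rev a) ∈ B then 1 else 0)) =
      ∑ S ∈ F, ((startsFrom ends F B S).card + (stopsTo ends F B S).card) := by
    simp only [startsFrom, stopsTo, Finset.card_filter]
  rw [h5] at h3
  have h6 : ∑ v ∈ B, (edgeCut ends (Biset.single v)).card ≤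
      ∑ S ∈ F, ((startsFrom ends F B S).card + (stopsTo ends F B S).card) +
        (idle ends F).card := by
    refine h2.trans (h3.le.trans ?_)
    omega
  exact_mod_cast h6

theorem two_mul_card (h : IsTightForest ends F B x γ) :
    2 * (Fintype.card E : ℝ) =
      ∑ S ∈ F, (((starts ends F S).card : ℝ) + (singleStops ends F S).card) +
      (idle ends F).card := by
  have h3 := h.forest.sum_halfEdges (ends := ends) fun _ => (1 : ℝ)
  simp only [Finset.sum_const, nsmul_eq_mul, mul_one, Finset.card_univ, Fintype.card_prod,
    Fintype.card_bool] at h3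
  rw [← h3]
  push_cast
  ring

open Classical in
/-- Lower bound for the surplus of tokens at a member of the forest. -/
theorem le_surplus (h : IsTightForest ends F B x γ) {α : ℤ} (hα : 4 ≤ α)
    (hlt : ∀ e, x e < 1 / (α : ℝ)) {M : ℝ} (hM : 3 / 2 ≤ M) {S : Biset V} (hS : S ∈ F) :
    ((M - 1) * (α + 1) - 2 * M + 2) * (if (children F S).card = 0 then 1 else 0)
      - 2 * (if S ∈ IsForest.homes F B then 1 else 0)
      - 2 * M * (if 2 ≤ (children F S).card then 1 else 0) - (IsForest.entering F B S).card
      - 2 * M * (if S = Biset.full then 1 else 0) ≤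
    M * ((starts ends F S).card + (singleStops ends F S).card - 2) -
      ((startsFrom ends F B S).card + (stopsTo ends F B S).card) := by
  have hα' : (4 : ℝ) ≤ α := by exact_mod_cast hα
  have hα0 : 0 < α := by omega
  have hs1 : ((startsFrom ends F B S).card : ℝ) ≤ (starts ends F S).card := by
    exact_mod_cast card_startsFrom_le S
  have hs2 : ((stopsTo ends F B S).card : ℝ) ≤ (singleStops ends F S).card := by
    exact_mod_cast card_stopsTo_le S
  have hsN : (0 : ℝ) ≤ (starts ends F S).card := Nat.cast_nonneg _
  have hnN : (0 : ℝ) ≤ (singleStops ends F S).card := Nat.cast_nonneg _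
  have hyN : (0 : ℝ) ≤ (startsFrom ends F B S).card := Nat.cast_nonneg _
  have haN : (0 : ℝ) ≤ (stopsTo ends F B S).card := Nat.cast_nonneg _
  have heN : (0 : ℝ) ≤ (IsForest.entering F B S).card := Nat.cast_nonneg _
  -- This worst case is allowed only at the root and at branchings.
  have hgen : -2 * M ≤ M * ((starts ends F S).card + (singleStops ends F S).card - 2) -
      ((startsFrom ends F B S).card + (stopsTo ends F B S).card) := by
    nlinarith [mul_nonneg (by linarith : 0 ≤ M - 1) hsN, mul_nonneg (by linarith : 0 ≤ M - 1) hnN]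
  by_cases hfull : S = Biset.full
  · have hc : (children F S).card ≠ 0 := by
      rw [hfull]
      exact (Finset.card_pos.2 h.children_full).ne'
    rw [if_pos hfull, if_neg hc]
    split_ifs <;> linarith
  rw [if_neg hfull]
  by_cases h0 : (children F S).card = 0
  · have hst := add_one_le_card_of_one_le_sum hα0 hlt (h.one_le_sum_starts_of_leaf hS hfull h0)
    have hn : ((singleStops ends F S).card : ℝ) = 0 := by
      rw [IsForest.singleStops_eq_empty h0]
      simp
    have hM1 := mul_le_mul_of_nonneg_left hst (by linarith : 0 ≤ M - 1)
    rw [if_pos h0, if_neg (by omega : ¬ 2 ≤ (children F S).card)]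
    by_cases hh : S ∈ IsForest.homes F B
    · rw [if_pos hh]
      nlinarith
    · rw [if_neg hh]
      have hy : ((startsFrom ends F B S).card : ℝ) = 0 := by
        rw [startsFrom_eq_empty hS hh]
        simp
      nlinarith
  rw [if_neg h0]
  by_cases h2 : 2 ≤ (children F S).card
  · rw [if_pos h2]
    split_ifs <;> linarith
  rw [if_neg h2]
  have h1 : (children F S).card = 1 := by omega
  have hd := h.forest.doubleStops_eq_empty (ends := ends) hS h1.le
  have hbal := h.integral_balance hS
  have hmov := h.moves S hS
  rw [hd] at hbal hmov
  simp only [Finset.sum_empty, add_zero, Finset.not_nonempty_empty, or_false] at hbal hmov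
  -- If only starts or only stops occur, their weight is a positive integer, so there are at least α
  -- + 1 ≥ 5 of them.
  have hcase : ((singleStops ends F S).card = 0 ∧ (5 : ℝ) ≤ (starts ends F S).card) ∨
      ((starts ends F S).card = 0 ∧ (5 : ℝ) ≤ (singleStops ends F S).card) ∨
      ((1 : ℝ) ≤ (starts ends F S).card ∧ (1 : ℝ) ≤ (singleStops ends F S).card) := by
    rcases Finset.eq_empty_or_nonempty (singleStops ends F S) with hn | hn
    · left
      have hs : (starts ends F S).Nonempty := by
        simpa [hn] using hmov
      rw [hn] at hbal ⊢
      simp only [Finset.sum_empty, sub_zero] at hbal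
      have := add_one_le_card_of_one_le_sum hα0 hlt (one_le_of_integral (h.sum_pos hs) hbal)
      exact ⟨rfl, by linarith⟩
    · right
      rcases Finset.eq_empty_or_nonempty (starts ends F S) with hs | hs
      · left
        rw [hs] at hbal ⊢
        obtain ⟨k, hk⟩ := hbal
        simp only [Finset.sum_empty, zero_sub] at hk
        have := add_one_le_card_of_one_le_sum hα0 hlt (one_le_of_integral (h.sum_pos hn)
          ⟨-k, by push_cast; linarith⟩)
        exact ⟨rfl, by linarith⟩
      · right
        exact ⟨by exact_mod_cast Finset.card_pos.2 hs, by exact_mod_cast Finset.card_pos.2 hn⟩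
  by_cases hh : S ∈ IsForest.homes F B
  · rw [if_pos hh]
    have hsum : (2 : ℝ) ≤ (starts ends F S).card + (singleStops ends F S).card := by
      rcases hcase with ⟨-, h5⟩ | ⟨-, h5⟩ | ⟨h5, h6⟩ <;> linarith
    nlinarith [mul_nonneg (by linarith : 0 ≤ M - 1) (sub_nonneg.2 hsum)]
  · rw [if_neg hh]
    have hy : ((startsFrom ends F B S).card : ℝ) = 0 := by
      rw [startsFrom_eq_empty hS hh]
      simp
    have hae : (stopsTo ends F B S).card = 0 ∨ (1 : ℝ) ≤ (IsForest.entering F B S).card := by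
      rcases Nat.eq_zero_or_pos (stopsTo ends F B S).card with ha | ha
      · exact Or.inl ha
      · exact Or.inr (by exact_mod_cast one_le_entering_of_stopsTo hS h1 hh ha)
    rw [hy]
    rcases hcase with ⟨hn, h5⟩ | ⟨hs, h5⟩ | ⟨h5, h6⟩
    · rw [hn] at hs2 ⊢
      push_cast at hs2 ⊢
      nlinarith
    · rw [hs]
      push_cast
      rcases hae with ha | ha
      · rw [ha]
        push_cast
        nlinarith
      · nlinarith
    · rcases hae with ha | ha
      · rw [ha]
        push_cast
        nlinarith
      · nlinarith [mul_nonneg (by linarith : 0 ≤ M - 1) (sub_nonneg.2 h6),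
          mul_nonneg (by linarith : 0 ≤ M) (sub_nonneg.2 h5)]

theorem card_branchings_le (h : IsTightForest ends F B x γ) :
    ((IsForest.branchings F).card : ℝ) + 1 ≤ (IsForest.leaves F).card := by
  exact_mod_cast h.forest.card_branchings_lt

theorem sum_entering_le (h : IsTightForest ends F B x γ) :
    ∑ S ∈ F, ((IsForest.entering F B S).card : ℝ) + γ ≤
      B.card + γ * (IsForest.leaves F).card := by
  exact_mod_cast h.forest.sum_entering_le B h.boundary_le

/-- If all edge weights are below `1 / α`, some node of `B` has small degree. -/
theorem exists_degree_lt (h : IsTightForest ends F B x γ) {α : ℤ} (hα : 4 ≤ α)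
    (hlt : ∀ e, x e < 1 / (α : ℝ)) {D : ℝ}
    (hDα : 4 * (((γ : ℝ) + 2) / ((α : ℝ) - 2)) + 6 ≤ D) :
    ∃ v ∈ B, ((edgeCut ends (Biset.single v)).card : ℝ) < D := by
  classical
  by_contra! hD
  have hα' : (4 : ℝ) ≤ α := by exact_mod_cast hα
  -- Per node of B, 2M pays for its share of the bound on |E|, 2 for its home and 1 for entering
  -- boundaries.
  obtain ⟨M, hMD⟩ : ∃ M : ℝ, D = 2 * M + 3 := ⟨(D - 3) / 2, by ring⟩
  set y : ℝ := ((γ : ℝ) + 2) / ((α : ℝ) - 2) with hy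
  have hγ : (0 : ℝ) ≤ γ := Nat.cast_nonneg γ
  have hy0 : 0 ≤ y := div_nonneg (by linarith) (by linarith)
  have hyα : y * (α - 2) = γ + 2 := div_mul_cancel₀ _ (by linarith)
  have hMy : 3 / 2 + 2 * y ≤ M := by linarith
  have hM : 3 / 2 ≤ M := by linarith
  -- This says that the number of leaves has a nonnegative coefficient in the final count, once
  -- branchings and entering nodes are charged to leaves.
  have hMα : (γ : ℝ) + α - 1 ≤ M * (α - 3) := by
    have := mul_le_mul_of_nonneg_right hMy (by linarith : (0 : ℝ) ≤ α - 3)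
    nlinarith [mul_nonneg hy0 (by linarith : (0 : ℝ) ≤ α - 4)]
  have hsum := Finset.sum_le_sum fun S hS => h.le_surplus hα hlt hM hS
  have hdeg := h.sum_degree_le hD
  have hE := h.two_mul_card
  have hbr := h.card_branchings_le
  have hent := h.sum_entering_le
  have hhm : ((IsForest.homes F B).card : ℝ) ≤ B.card := by
    exact_mod_cast h.forest.card_homes_le B
  have hcard : (Fintype.card E : ℝ) + 1 ≤ F.card + B.card := by exact_mod_cast h.card_le
  have hleaf : ∑ S ∈ F, (if (children F S).card = 0 then (1 : ℝ) else 0) =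
      (IsForest.leaves F).card := by
    rw [Finset.sum_boole]
    rfl
  have hbrs : ∑ S ∈ F, (if 2 ≤ (children F S).card then (1 : ℝ) else 0) =
      (IsForest.branchings F).card := by
    rw [Finset.sum_boole]
    rfl
  have hhms : ∑ S ∈ F, (if S ∈ IsForest.homes F B then (1 : ℝ) else 0) =
      (IsForest.homes F B).card := by
    rw [Finset.sum_boole, Finset.filter_mem_eq_inter,
      Finset.inter_eq_right.2 (fun S hS => (mem_homes.1 hS).1)]
  have hfulls : ∑ S ∈ F, (if S = Biset.full then (1 : ℝ) else 0) = 1 := by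
    rw [Finset.sum_ite_eq' F, if_pos h.forest.full_mem]
  simp only [Finset.sum_sub_distrib, ← Finset.mul_sum, hleaf, hbrs, hhms, hfulls,
    Finset.sum_const, nsmul_eq_mul] at hsum
  have hidle : (0 : ℝ) ≤ (idle ends F).card := Nat.cast_nonneg _
  have hℓ : (0 : ℝ) ≤ (IsForest.leaves F).card := Nat.cast_nonneg _
  have h1 : M * (2 * Fintype.card E - 2 * F.card) ≤ M * (2 * B.card - 2) :=
    mul_le_mul_of_nonneg_left (by linarith) (by linarith)
  have h2 := mul_le_mul_of_nonneg_left hbr (by linarith : 0 ≤ 2 * M)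
  have h3 : 0 ≤ (M * (α - 3) - (γ + α - 1)) * (IsForest.leaves F).card :=
    mul_nonneg (by linarith) hℓ
  have h4 : (idle ends F).card ≤ M * (idle ends F).card := by nlinarith
  rw [hMD] at hdeg
  rw [hE] at h1
  nlinarith

end IsTightForest

end Counting

/-! ### Fractional tokens and the degree bound for weights below 1/2. -/

section HalfIntegral

variable {V E : Type*} [Fintype V] [Fintype E]

open Classical in
/-- The tokens received by `S`: the weight of the edges starting there, and what remains of one
token of each edge that stops there. -/
noncomputable def tokens (ends : E → Sym2 V) (F : Finset (Biset V)) (x : E → ℝ) (S : Biset V) :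
    ℝ :=
  ∑ a ∈ starts ends F S, x a.1 + ∑ a ∈ singleStops ends F S, (1 - x a.1) +
    ∑ a ∈ doubleStops ends F S, (1 / 2 - x a.1) +
    (if S = Biset.full then ((idle ends F).card : ℝ) / 2 else 0)

/-- The part of `tokens` due to the edges stopping at `S` in both directions. -/
noncomputable def doubleTokens (ends : E → Sym2 V) (F : Finset (Biset V)) (x : E → ℝ)
    (S : Biset V) : ℝ := ∑ a ∈ doubleStops ends F S, (1 / 2 - x a.1)

variable {ends : E → Sym2 V} {F : Finset (Biset V)} {B : Finset V} {x : E → ℝ} {γ : ℕ}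

namespace IsTightForest

theorem one_le_tokens (h : IsTightForest ends F B x γ) (hlt : ∀ e, x e < 1 / 2) {S : Biset V}
    (hS : S ∈ F) : ∃ k : ℤ, 1 ≤ k ∧ tokens ends F x S = k := by
  classical
  obtain ⟨k, hk⟩ := h.integral_balance hS
  -- Parity turns the halves contributed by double stops and idle copies into integers.
  obtain ⟨d, hd⟩ := h.forest.two_dvd_card_doubleStops (ends := ends) hS
  obtain ⟨i, hi⟩ := IsForest.two_dvd_card_idle (ends := ends) (F := F)
  have hint : ∃ k : ℤ, tokens ends F x S = k := by
    refine ⟨k + (singleStops ends F S).card + d + if S = Biset.full then (i : ℤ) else 0, ?_⟩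
    unfold tokens
    rw [Finset.sum_sub_distrib, Finset.sum_sub_distrib, Finset.sum_const, Finset.sum_const, hd, hi]
    push_cast
    rw [← hk]
    simp only [nsmul_eq_mul]
    split_ifs <;> push_cast <;> ring
  have h1 : 0 ≤ ∑ a ∈ starts ends F S, x a.1 := Finset.sum_nonneg fun a _ => (h.pos a.1).le
  have h2 : 0 ≤ ∑ a ∈ singleStops ends F S, (1 - x a.1) :=
    Finset.sum_nonneg fun a _ => by linarith [hlt a.1]
  have h3 : 0 ≤ ∑ a ∈ doubleStops ends F S, (1 / 2 - x a.1) :=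
    Finset.sum_nonneg fun a _ => by linarith [hlt a.1]
  have h4 : 0 ≤ (if S = Biset.full then ((idle ends F).card : ℝ) / 2 else 0) := by
    split_ifs <;> positivity
  have hpos : 0 < tokens ends F x S := by
    unfold tokens
    rcases h.moves S hS with hm | hm | hm
    · have := h.sum_pos hm
      linarith
    · have : 0 < ∑ a ∈ singleStops ends F S, (1 - x a.1) :=
        Finset.sum_pos (fun a _ => by linarith [hlt a.1]) hm
      linarith
    · have : 0 < ∑ a ∈ doubleStops ends F S, (1 / 2 - x a.1) :=
        Finset.sum_pos (fun a _ => by linarith [hlt a.1]) hm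
      linarith
  obtain ⟨k', hk'⟩ := hint
  refine ⟨k', ?_, hk'⟩
  rw [hk'] at hpos
  have : 0 < k' := by exact_mod_cast hpos
  omega

/-- An edge active in one direction gives x and 1 - x, one active in both gives x and 1/2 - x twice,
and an idle edge gives 1/2 twice to the root. -/
theorem sum_tokens (h : IsTightForest ends F B x γ) :
    ∑ S ∈ F, tokens ends F x S = Fintype.card E := by
  classical
  have h1 := h.forest.sum_starts_eq_sum_stops (ends := ends) fun a => x a.1
  have h2 := h.forest.sum_starts_eq_sum_stops (ends := ends) fun _ => (1 : ℝ)
  have h3 := h.two_mul_card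
  simp only [tokens, Finset.sum_sub_distrib, Finset.sum_add_distrib, Finset.sum_const,
    nsmul_eq_mul, mul_one, ← Finset.sum_mul] at h1 h2 h3 ⊢
  rw [Finset.sum_ite_eq' F, if_pos h.forest.full_mem]
  linarith

/-- Every edge stopping in both directions has started from a node of `B`. -/
theorem sum_doubleStops_le (h : IsTightForest ends F B x γ) (hB : ∀ e, ∃ v ∈ B, v ∈ ends e) :
    ∑ S ∈ F, ∑ a ∈ doubleStops ends F S, x a.1 ≤
      2 * ∑ S ∈ F, ∑ a ∈ startsFrom ends F B S, x a.1 := by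
  classical
  have h1 : ∑ S ∈ F, ∑ a ∈ startsFrom ends F B S, x a.1 =
      ∑ a with Active ends F a, (if tail ends a ∈ B then x a.1 else 0) := by
    rw [← h.forest.sum_starts]
    simp only [startsFrom, Finset.sum_filter]
  have h2 : ∑ a with Active ends F a ∧ Active ends F (rev a), (if tail ends a ∈ B then x a.1 else 0)
      ≤ ∑ a with Active ends F a, (if tail ends a ∈ B then x a.1 else 0) := by
    refine Finset.sum_le_sum_of_subset_of_nonneg (fun a ha => ?_) fun a _ _ => ?_
    · simp only [Finset.mem_filter, Finset.mem_univ, true_and] at ha ⊢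
      exact ha.1
    · split_ifs
      · exact (h.pos a.1).le
      · exact le_rfl
  have h3 : ∑ a with Active ends F a ∧ Active ends F (rev a),
      (if tail ends (rev a) ∈ B then x a.1 else 0) =
      ∑ a with Active ends F a ∧ Active ends F (rev a), (if tail ends a ∈ B then x a.1 else 0) := by
    refine Finset.sum_bij' (fun a _ => rev a) (fun a _ => rev a) ?_ ?_ ?_ ?_ ?_ <;>
      simp +contextual
  -- One of the two copies has its tail in B; reversal symmetry then produces the factor 2.
  have h4 : ∑ a with Active ends F a ∧ Active ends F (rev a), x a.1 ≤
      ∑ a with Active ends F a ∧ Active ends F (rev a), ((if tail ends a ∈ B then x a.1 else 0) +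
        (if tail ends (rev a) ∈ B then x a.1 else 0)) := by
    refine Finset.sum_le_sum fun a _ => ?_
    obtain ⟨v, hv, hve⟩ := hB a.1
    rw [ends_eq_tail_rev ends a, Sym2.mem_iff] at hve
    have := h.pos a.1
    rcases hve with rfl | rfl
    · rw [if_pos hv]
      split_ifs <;> linarith
    · rw [if_pos hv]
      split_ifs <;> linarith
  rw [Finset.sum_add_distrib, h3] at h4
  rw [h.forest.sum_doubleStops, h1]
  linarith

/-- A weighted count bounding the number of edges that start from a node of `B`. -/
noncomputable def charge (ends : E → Sym2 V) (F : Finset (Biset V)) (B : Finset V) (x : E → ℝ)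
    (S : Biset V) : ℝ :=
  (singleStops ends F S).card - ((starts ends F S).card - (startsFrom ends F B S).card) +
    2 * doubleTokens ends F x S + 4 * ∑ a ∈ startsFrom ends F B S, x a.1

/-- Starts and stops cancel in the total charge. What remains besides the starts from B is four
times their weight minus twice the doubly stopping weight, which is nonnegative by
`sum_doubleStops_le`. -/
theorem sum_startsFrom_le_charge (h : IsTightForest ends F B x γ)
    (hB : ∀ e, ∃ v ∈ B, v ∈ ends e) :
    ∑ S ∈ F, ((startsFrom ends F B S).card : ℝ) ≤ ∑ S ∈ F, charge ends F B x S := by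
  have h1 := h.sum_doubleStops_le hB
  have h2 := h.forest.sum_starts_eq_sum_stops (ends := ends) fun _ => (1 : ℝ)
  simp only [charge, doubleTokens, Finset.sum_sub_distrib, Finset.sum_add_distrib,
    Finset.sum_const, nsmul_eq_mul, mul_one, ← Finset.sum_mul, ← Finset.mul_sum] at h1 h2 ⊢
  linarith

/-- The numerical data at a member of the forest, when all weights are below `1 / 2`. -/
theorem local_data (h : IsTightForest ends F B x γ) (hlt : ∀ e, x e < 1 / 2) (S : Biset V) :
    ∃ p i r : ℝ, tokens ends F x S = r + ∑ a ∈ startsFrom ends F B S, x a.1 + p +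
        doubleTokens ends F x S + i ∧ 0 ≤ p ∧ 0 ≤ i ∧ 0 ≤ r ∧
      0 ≤ ∑ a ∈ startsFrom ends F B S, x a.1 ∧ 0 ≤ doubleTokens ends F x S ∧
      (1 ≤ (singleStops ends F S).card → ((singleStops ends F S).card : ℝ) < 2 * p ∧
        p < (singleStops ends F S).card) ∧
      (0 < r → (startsFrom ends F B S).card + 1 ≤ (starts ends F S).card) ∧
      (S = Biset.full → i = ((idle ends F).card : ℝ) / 2) ∧ (S ≠ Biset.full → i = 0) := by
  classical
  have hr : ∑ a ∈ starts ends F S, x a.1 = ∑ a ∈ startsFrom ends F B S, x a.1 +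
      ∑ a ∈ (starts ends F S).filter (fun a => tail ends a ∉ B), x a.1 :=
    (Finset.sum_filter_add_sum_filter_not _ (fun a => tail ends a ∈ B) _).symm
  refine ⟨∑ a ∈ singleStops ends F S, (1 - x a.1),
    if S = Biset.full then ((idle ends F).card : ℝ) / 2 else 0,
    ∑ a ∈ (starts ends F S).filter (fun a => tail ends a ∉ B), x a.1, ?_, ?_, ?_, ?_, ?_, ?_, ?_,
    ?_, fun hS => if_pos hS, fun hS => if_neg hS⟩
  · rw [tokens, doubleTokens, hr]
    ring
  · exact Finset.sum_nonneg fun a _ => by linarith [hlt a.1]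
  · split_ifs <;> positivity
  · exact Finset.sum_nonneg fun a _ => (h.pos a.1).le
  · exact Finset.sum_nonneg fun a _ => (h.pos a.1).le
  · exact Finset.sum_nonneg fun a _ => by linarith [hlt a.1]
  · intro hn
    have hne : (singleStops ends F S).Nonempty := Finset.card_pos.1 hn
    have h1 : ∑ _a ∈ singleStops ends F S, (1 / 2 : ℝ) < ∑ a ∈ singleStops ends F S, (1 - x a.1) :=
      Finset.sum_lt_sum_of_nonempty hne fun a _ => by linarith [hlt a.1]
    have h2 : ∑ a ∈ singleStops ends F S, (1 - x a.1) < ∑ _a ∈ singleStops ends F S, (1 : ℝ) :=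
      Finset.sum_lt_sum_of_nonempty hne fun a _ => by linarith [h.pos a.1]
    rw [Finset.sum_const, nsmul_eq_mul] at h1 h2
    constructor <;> linarith
  · intro hpos
    have hne : ((starts ends F S).filter (fun a => tail ends a ∉ B)).Nonempty := by
      rw [Finset.nonempty_iff_ne_empty]
      intro he
      rw [he, Finset.sum_empty] at hpos
      exact hpos.false
    have h1 := Finset.card_pos.2 hne
    have h2 := Finset.card_filter_add_card_filter_not (s := starts ends F S)
      (fun a => tail ends a ∈ B)
    rw [startsFrom]
    omega

open Classical in
theorem charge_le (h : IsTightForest ends F B x γ) (hlt : ∀ e, x e < 1 / 2) {S : Biset V}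
    (hS : S ∈ F) :
    charge ends F B x S ≤ 4 * (tokens ends F x S - 1) +
      4 * (if S ∈ IsForest.homes F B then 1 else 0) + 4 * (if S = Biset.full then 1 else 0) +
      2 * (if 2 ≤ (children F S).card then 1 else 0) -
      3 * (if (children F S).card = 0 ∧ S ∉ IsForest.homes F B then 1 else 0) ∧
    charge ends F B x S + (stopsTo ends F B S).card +
        (if S = Biset.full then ((idle ends F).card : ℝ) else 0) ≤
      5 * (tokens ends F x S - 1) +
      4 * (if S ∈ IsForest.homes F B then 1 else 0) + 4 * (if S = Biset.full then 1 else 0) +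
      3 * (if 2 ≤ (children F S).card then 1 else 0) + (IsForest.entering F B S).card -
      3 * (if (children F S).card = 0 ∧ S ∉ IsForest.homes F B then 1 else 0) := by
  obtain ⟨p, i, r, ht, hp, hi, hr, hy, hq, hn1, hrs, hfi, hfi'⟩ := h.local_data (B := B) hlt S
  obtain ⟨k, hk1, hk⟩ := h.one_le_tokens hlt hS
  have hs1 : ((startsFrom ends F B S).card : ℝ) ≤ (starts ends F S).card := by
    exact_mod_cast card_startsFrom_le S
  have hs2 : ((stopsTo ends F B S).card : ℝ) ≤ (singleStops ends F S).card := by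
    exact_mod_cast card_stopsTo_le S
  have heN : (0 : ℝ) ≤ (IsForest.entering F B S).card := Nat.cast_nonneg _
  have hn : ((singleStops ends F S).card : ℝ) ≤ 2 * p := by
    rcases Nat.eq_zero_or_pos (singleStops ends F S).card with h0 | h0
    · rw [h0]
      push_cast
      linarith
    · exact (hn1 h0).1.le
  have hk1' : (1 : ℝ) ≤ k := by exact_mod_cast hk1
  by_cases hfull : S = Biset.full
  · have hc : (children F S).card ≠ 0 := by
      rw [hfull]
      exact (Finset.card_pos.2 h.children_full).ne'
    have := hfi hfull
    rw [if_pos hfull, if_pos hfull,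
      if_neg (fun hh : (children F S).card = 0 ∧ S ∉ IsForest.homes F B => hc hh.1)]
    unfold charge
    constructor <;> split_ifs <;> linarith
  have hi0 := hfi' hfull
  rw [if_neg hfull, if_neg hfull]
  by_cases hh : S ∈ IsForest.homes F B
  · rw [if_pos hh, if_neg (fun hc : (children F S).card = 0 ∧ S ∉ IsForest.homes F B => hc.2 hh)]
    unfold charge
    constructor <;> split_ifs <;> linarith
  have hyc : startsFrom ends F B S = ∅ := startsFrom_eq_empty hS hh
  rw [if_neg hh]
  rw [hyc] at ht hrs hs1
  simp only [Finset.sum_empty, Finset.card_empty, zero_add, CharP.cast_eq_zero] at ht hrs hs1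
  by_cases h0 : (children F S).card = 0
  · have hst := add_one_le_card_of_one_le_sum (α := 2) (by norm_num)
      (fun e => by simpa using hlt e) (h.one_le_sum_starts_of_leaf hS hfull h0)
    have hn := IsForest.singleStops_eq_empty (ends := ends) h0
    have hd := h.forest.doubleStops_eq_empty (ends := ends) hS (by omega)
    rw [hn] at hs2
    rw [if_neg (by omega : ¬ 2 ≤ (children F S).card),
      if_pos (⟨h0, hh⟩ : (children F S).card = 0 ∧ S ∉ IsForest.homes F B)]
    simp only [charge, doubleTokens, hyc, hn, hd, Finset.sum_empty, Finset.card_empty,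
      CharP.cast_eq_zero] at hs2 ⊢
    push_cast at hst
    constructor <;> linarith
  rw [if_neg (fun hc : (children F S).card = 0 ∧ S ∉ IsForest.homes F B => h0 hc.1)]
  -- Each single stop leaves more than 1/2 of a token, so their number is below 2k; at the extreme
  -- value 2k - 1 less than 1/2 remains for the double stops.
  have hcase : (singleStops ends F S).card = 0 ∨
      (((singleStops ends F S).card : ℝ) + 2 ≤ 2 * k ∧ (2 : ℝ) ≤ k) ∨
      (((singleStops ends F S).card : ℝ) + 1 = 2 * k ∧ doubleTokens ends F x S < 1 / 2) := by
    rcases Nat.eq_zero_or_pos (singleStops ends F S).card with hz | hz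
    · exact Or.inl hz
    · right
      have h1 := (hn1 hz).1
      have h2 : ((singleStops ends F S).card : ℝ) < 2 * k := by linarith
      have h3 : ((singleStops ends F S).card : ℤ) < 2 * k := by exact_mod_cast h2
      rcases (by omega : ((singleStops ends F S).card : ℤ) + 2 ≤ 2 * k ∧ 2 ≤ k ∨
        ((singleStops ends F S).card : ℤ) + 1 = 2 * k) with h4 | h4
      · left
        exact ⟨by exact_mod_cast h4.1, by exact_mod_cast h4.2⟩
      · right
        have h5 : ((singleStops ends F S).card : ℝ) + 1 = 2 * k := by exact_mod_cast h4
        exact ⟨h5, by linarith⟩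
  by_cases h2 : 2 ≤ (children F S).card
  · rw [if_pos h2]
    simp only [charge, hyc, Finset.sum_empty, Finset.card_empty, CharP.cast_eq_zero]
    rcases hcase with hz | ⟨hz, -⟩ | ⟨hz, hz'⟩
    · rw [hz] at hs2 ⊢
      push_cast at hs2 ⊢
      constructor <;> linarith
    · constructor <;> linarith
    · constructor <;> linarith
  rw [if_neg h2]
  have h1 : (children F S).card = 1 := by omega
  have hd := h.forest.doubleStops_eq_empty (ends := ends) hS h1.le
  have hd0 : doubleTokens ends F x S = 0 := by
    rw [doubleTokens, hd, Finset.sum_empty]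
  have hae : (stopsTo ends F B S).card = 0 ∨ (1 : ℝ) ≤ (IsForest.entering F B S).card := by
    rcases Nat.eq_zero_or_pos (stopsTo ends F B S).card with ha | ha
    · exact Or.inl ha
    · exact Or.inr (by exact_mod_cast one_le_entering_of_stopsTo hS h1 hh ha)
  simp only [charge, hyc, hd0, Finset.sum_empty, Finset.card_empty, CharP.cast_eq_zero]
  rcases hcase with hz | ⟨hz, hz'⟩ | ⟨hz, -⟩
  · rw [hz] at hs2 ⊢
    push_cast at hs2 ⊢
    constructor <;> linarith
  · rcases hae with ha | ha
    · rw [ha]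
      push_cast
      constructor <;> linarith
    · constructor <;> linarith
  · rcases (by omega : k = 1 ∨ 2 ≤ k) with hk2 | hk2
    -- One single stop leaves less than a full token, so some copy starts at S from outside B and
    -- compensates for it in the charge.
    · have hk3 : (k : ℝ) = 1 := by exact_mod_cast hk2
      have hn3 : (singleStops ends F S).card = 1 := by
        have : ((singleStops ends F S).card : ℝ) = 1 := by linarith
        exact_mod_cast this
      have hp1 := (hn1 (by omega)).2
      have hν : (1 : ℝ) ≤ (starts ends F S).card := by
        exact_mod_cast hrs (by rw [hn3] at hp1; push_cast at hp1; linarith)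
      rw [hn3] at hs2 ⊢
      push_cast at hs2 ⊢
      rcases hae with ha | ha
      · rw [ha]
        push_cast
        constructor <;> linarith
      · constructor <;> linarith
    · have hk3 : (2 : ℝ) ≤ k := by exact_mod_cast hk2
      rcases hae with ha | ha
      · rw [ha]
        push_cast
        constructor <;> linarith
      · constructor <;> linarith

/-- If all edge weights are below `1 / 2` and each edge is incident to `B`, then some node of `B`
has small degree. -/
theorem exists_degree_le (h : IsTightForest ends F B x γ) (hlt : ∀ e, x e < 1 / 2)
    (hB : ∀ e, ∃ v ∈ B, v ∈ ends e) :
    ∃ v ∈ B, ((edgeCut ends (Biset.single v)).card : ℝ) ≤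
      1.5 * (γ : ℝ) ^ 2 + 7.5 * (γ : ℝ) + 16 := by
  classical
  by_contra! hD
  have hdeg := h.sum_degree_le (fun v hv => (hD v hv).le)
  have hch := h.sum_startsFrom_le_charge hB
  have h1 := Finset.sum_le_sum fun S hS => (h.charge_le (B := B) hlt hS).1
  have h2 := Finset.sum_le_sum fun S hS => (h.charge_le (B := B) hlt hS).2
  have htok := h.sum_tokens
  have hbr := h.card_branchings_le
  have hent := h.sum_entering_le
  have hhm : ((IsForest.homes F B).card : ℝ) ≤ B.card := by
    exact_mod_cast h.forest.card_homes_le B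
  have hcard : (Fintype.card E : ℝ) + 1 ≤ F.card + B.card := by exact_mod_cast h.card_le
  have hbrs : ∑ S ∈ F, (if 2 ≤ (children F S).card then (1 : ℝ) else 0) =
      (IsForest.branchings F).card := by
    rw [Finset.sum_boole]
    rfl
  have hhms : ∑ S ∈ F, (if S ∈ IsForest.homes F B then (1 : ℝ) else 0) =
      (IsForest.homes F B).card := by
    rw [Finset.sum_boole, Finset.filter_mem_eq_inter,
      Finset.inter_eq_right.2 (fun S hS => (mem_homes.1 hS).1)]
  have hfulls : ∀ c : ℝ, ∑ S ∈ F, (if S = Biset.full then c else 0) = c := by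
    intro c
    rw [Finset.sum_ite_eq' F, if_pos h.forest.full_mem]
  have hfree : ((IsForest.leaves F).card : ℝ) ≤ ∑ S ∈ F,
      (if (children F S).card = 0 ∧ S ∉ IsForest.homes F B then (1 : ℝ) else 0) +
        (IsForest.homes F B).card := by
    rw [← hhms, ← Finset.sum_add_distrib, IsForest.leaves, ← Finset.sum_boole]
    refine Finset.sum_le_sum fun S _ => ?_
    split_ifs <;> simp_all
  simp only [Finset.sum_sub_distrib, Finset.sum_add_distrib, ← Finset.mul_sum, hbrs, hhms, hfulls,
    Finset.sum_const, nsmul_eq_mul, mul_one, htok] at h1 h2 hdeg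
  have hnn : (0 : ℝ) ≤ ∑ S ∈ F, ((startsFrom ends F B S).card : ℝ) :=
    Finset.sum_nonneg fun S _ => Nat.cast_nonneg _
  have hγ : (0 : ℝ) ≤ γ := Nat.cast_nonneg γ
  have hβ : (0 : ℝ) ≤ B.card := Nat.cast_nonneg _
  -- The charge total is nonnegative. Branchings cost 2 each, but leaves that are no home gain 3, so
  -- one unit per leaf survives against 4 + 4 + 3 per node of B.
  have hℓ : ((IsForest.leaves F).card : ℝ) ≤ 11 * B.card := by linarith
  have h3 := mul_le_mul_of_nonneg_left hℓ hγ
  -- The count gives the linear bound 11γ + 13, and the quadratic one exceeds it by this polynomial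
  -- of negative discriminant.
  have h4 : 0 ≤ (1.5 * (γ : ℝ) ^ 2 - 3.5 * γ + 3) * B.card := by
    refine mul_nonneg ?_ hβ
    nlinarith [sq_nonneg ((γ : ℝ) - 7 / 6)]
  linarith

end IsTightForest

end HalfIntegral

/-! ### From extreme points to tight forests. -/

section Extreme

variable {V E : Type*} [Fintype V] [Fintype E] {ends : E → Sym2 V}

theorem cutVec_nonneg {V E : Type*} (ends : E → Sym2 V) (S : Biset V) (e : E) :
    0 ≤ cutVec ends S e := by
  unfold cutVec
  split_ifs <;> norm_num

theorem cutVec_full {V E : Type*} [Fintype V] {ends : E → Sym2 V} (e : E) :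
    cutVec ends Biset.full e = 0 := by
  unfold cutVec
  rw [if_neg]
  rintro ⟨u, v, -, -, hv⟩
  exact hv (Finset.mem_univ v)

/-- Independence of the incidence vectors makes an edge start or stop at every member. -/
theorem IsForest.exists_move {F L : Finset (Biset V)} (hF : IsForest F)
    (hFL : ∀ S, S ∈ F ↔ S = Biset.full ∨ S ∈ L)
    (hind : LinearIndepOn ℝ (cutVec ends) (L : Set (Biset V)))
    (hfull : (children F Biset.full).Nonempty) {S : Biset V} (hS : S ∈ F) :
    (starts ends F S).Nonempty ∨ (singleStops ends F S).Nonempty ∨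
      (doubleStops ends F S).Nonempty := by
  classical
  by_contra! hcon
  obtain ⟨h1, h2, h3⟩ := hcon
  have hfullL : Biset.full ∉ L := fun h => hind.ne_zero h (funext fun e => cutVec_full e)
  have hchL : ∀ C ∈ children F S, C ∈ L := fun C hC =>
    ((hFL C).1 (mem_of_child hC)).resolve_left (child_ne_full hC)
  have hbal : ∀ e, cutVec ends S e = ∑ C ∈ children F S, cutVec ends C e := by
    intro e
    -- Without starts and stops, the balance for a unit vector expresses the cut of S through those
    -- of its children, a nontrivial relation in L. At the root, where the cut vanishes,
    -- nontriviality needs a child.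
    have hb := hF.cutVec_balance (ends := ends) S (Pi.single e 1)
    simpa [h1, h2, h3, Pi.single_apply] using hb
  have hS' : ∑ T ∈ L, (if T = S then (1 : ℝ) else 0) • cutVec ends T = cutVec ends S := by
    simp only [ite_smul, one_smul, zero_smul, Finset.sum_ite_eq']
    split_ifs with hSL
    · rfl
    · rw [((hFL S).1 hS).resolve_right hSL]
      exact funext fun e => (cutVec_full e).symm
  have hch : ∑ T ∈ L, (if T ∈ children F S then (1 : ℝ) else 0) • cutVec ends T =
      ∑ C ∈ children F S, cutVec ends C := by
    simp only [ite_smul, one_smul, zero_smul]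
    rw [← Finset.sum_filter, Finset.filter_mem_eq_inter, Finset.inter_eq_right.2 hchL]
  have hzero : ∑ T ∈ L, ((if T = S then (1 : ℝ) else 0) -
      (if T ∈ children F S then (1 : ℝ) else 0)) • cutVec ends T = 0 := by
    simp only [sub_smul, Finset.sum_sub_distrib]
    rw [hS', hch, sub_eq_zero]
    funext e
    rw [hbal e, Finset.sum_apply]
  have hg := linearIndepOn_finset_iff.1 hind _ hzero
  rcases (hFL S).1 hS with rfl | hSL
  · obtain ⟨C, hC⟩ := hfull
    have := hg C (hchL C hC)
    rw [if_neg (child_ne_full hC), if_pos hC] at this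
    norm_num at this
  · have := hg S hSL
    rw [if_pos rfl, if_neg fun h => (lt_of_child h).false] at this
    norm_num at this

variable [DecidableEq V] [Nonempty E] {f : Biset V → ℤ} {B : Finset V} {b : B → ℝ} {x : E → ℝ}

/-- An extreme point with no tight box constraint gives rise to a tight forest, unless some node
of `B` has degree at most two. -/
theorem exists_tightForest (hf : Biset.SkewSupermodular f)
    (hx : x ∈ Set.extremePoints ℝ (bisetPolytope ends f B b))
    (hpos : ∀ e, 0 < x e) (hlt : ∀ e, x e < 1) :
    (∃ v ∈ B, (edgeCut ends (Biset.single v)).card ≤ 2) ∨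
      ∃ F, IsTightForest ends F B x (Biset.gamma f) := by
  classical
  have hcov : ∀ S : Biset V, (f S : ℝ) ≤ ∑ e, cutVec ends S e * x e := fun S => by
    rw [← sum_edgeCut]
    exact hx.1.1 S
  obtain ⟨L, ht, hlam, hind, hspan⟩ := exists_laminar_basis ends hf hpos hcov
  have hcard := card_le_of_extreme ends hx hpos hlt hspan
  -- If L is empty, then |E| ≤ |B|, and degrees of at least 3 would give 3|B| ≤ 2|E|.
  rcases L.eq_empty_or_nonempty with rfl | hL
  · left
    by_contra! hD
    have h1 : 3 * B.card ≤ ∑ v ∈ B, (edgeCut ends (Biset.single v)).card := by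
      rw [mul_comm, ← smul_eq_mul, ← Finset.sum_const]
      exact Finset.sum_le_sum hD
    have h2 := (h1.trans (sum_degree_le ends B)).trans (Finset.card_le_univ _)
    rw [Fintype.card_prod, Fintype.card_bool] at h2
    have h3 : 0 < Fintype.card E := Fintype.card_pos
    rw [Finset.card_empty] at hcard
    omega
  right
  have hedge : ∀ S ∈ L, ∃ e, cutVec ends S e ≠ 0 := fun S hS =>
    Function.ne_iff.1 (hind.ne_zero hS)
  have hfpos : ∀ S ∈ L, 0 < f S := by
    intro S hS
    obtain ⟨e, he⟩ := hedge S hS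
    have h1 : 0 < ∑ e, cutVec ends S e * x e :=
      Finset.sum_pos' (fun e _ => mul_nonneg (cutVec_nonneg ends S e) (hpos e).le)
        ⟨e, Finset.mem_univ e, mul_pos ((cutVec_nonneg ends S e).lt_of_ne' he) (hpos e)⟩
    have h2 : (f S : ℝ) = ∑ e, cutVec ends S e * x e := ht S hS
    rw [← h2] at h1
    exact_mod_cast h1
  have hfullL : Biset.full ∉ L := fun h => hind.ne_zero h (funext fun e => cutVec_full e)
  obtain ⟨e₀⟩ := ‹Nonempty E›
  have hF : IsForest (insert Biset.full L) := by
    refine ⟨Finset.mem_insert_self _ _, ?_, ?_⟩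
    · simp only [Finset.forall_mem_insert]
      exact ⟨⟨Or.inl le_rfl, fun T _ => Or.inr (Or.inl T.le_full)⟩,
        fun S hS => ⟨Or.inl S.le_full, hlam S hS⟩⟩
    · simp only [Finset.forall_mem_insert]
      refine ⟨⟨tail ends (e₀, true), Finset.mem_univ _⟩, fun S hS => ?_⟩
      obtain ⟨e, he⟩ := hedge S hS
      have hc : EdgeCovers ends e S := by
        by_contra hn
        exact he (if_neg hn)
      obtain ⟨u, v, -, hu, -⟩ := hc
      exact ⟨u, hu⟩
  have hfull : (children (insert Biset.full L) Biset.full).Nonempty := by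
    obtain ⟨S, hS⟩ := hL
    obtain ⟨C, hC, -⟩ := hF.exists_child_ge hF.full_mem (Finset.mem_insert_of_mem hS)
      (lt_of_le_of_ne S.le_full fun h => hfullL (h ▸ hS))
    exact ⟨C, hC⟩
  refine ⟨insert Biset.full L, hF, hpos, ?_, ?_, ?_, ?_, hfull, ?_⟩
  · simp only [Finset.forall_mem_insert]
    refine ⟨⟨0, ?_⟩, fun S hS => ⟨f S, (ht S hS).symm⟩⟩
    simp [cutVec_full]
  · simp only [Finset.forall_mem_insert]
    refine ⟨fun h => absurd rfl h, fun S hS _ => ?_⟩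
    have h2 : (f S : ℝ) = ∑ e, cutVec ends S e * x e := ht S hS
    rw [← h2]
    exact_mod_cast hfpos S hS
  · simp only [Finset.forall_mem_insert]
    refine ⟨fun U hU => ?_, fun S hS U hU => ?_⟩
    · have : U = ∅ := Finset.eq_empty_of_forall_notMem fun v hv =>
        (hU v hv).2 (Finset.mem_univ v)
      simp [this]
    · have h1 : U ⊆ S.boundary := fun v hv => Finset.mem_sdiff.2 (hU v hv)
      refine (Finset.card_le_card h1).trans ?_
      exact Finset.le_sup (f := fun S : Biset V => S.boundary.card)
        (Finset.mem_filter.2 ⟨Finset.mem_univ S, hfpos S hS⟩)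
  · exact fun S hS => hF.exists_move (fun T => Finset.mem_insert) hind hfull hS
  · rw [Finset.card_insert_of_notMem hfullL]
    omega

end Extreme

/-! ### Both degree bounds for extreme points. -/

theorem theoremt {V E : Type*} [Fintype V] [DecidableEq V] [Fintype E] [Nonempty E]
    (ends : E → Sym2 V) (f : Biset V → ℤ) (hf : Biset.SkewSupermodular f)
    (B : Finset V) (b : B → ℝ)
    (x : E → ℝ) (hx : x ∈ Set.extremePoints ℝ (bisetPolytope ends f B b)) :
    (∀ α : ℤ, 4 ≤ α →
      (∃ e : E, x e = 0 ∨ 1 / (α : ℝ) ≤ x e) ∨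
      (∃ v ∈ B, ((edgeCut ends (Biset.single v)).card : ℤ) ≤
        ⌈4 * (((Biset.gamma f : ℝ) + 2) / ((α : ℝ) - 2))⌉ + 5)) ∧
    ((∀ e : E, ∃ v ∈ B, v ∈ ends e) →
      (∃ e : E, x e = 0 ∨ 1 / 2 ≤ x e) ∨
      (∃ v ∈ B, ((edgeCut ends (Biset.single v)).card : ℝ) ≤
        1.5 * (Biset.gamma f : ℝ) ^ 2 + 7.5 * (Biset.gamma f : ℝ) + 16)) := by
  have hγ : (0 : ℝ) ≤ Biset.gamma f := Nat.cast_nonneg _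
  have hnn : ∀ e, 0 ≤ x e := fun e => (hx.1.2.2 e).1
  constructor
  · intro α hα
    have hα' : (4 : ℝ) ≤ α := by exact_mod_cast hα
    rw [or_iff_not_imp_left]
    intro hne
    push Not at hne
    have hlt1 : ∀ e, x e < 1 := fun e => (hne e).2.trans_le (by
      rw [div_le_one (by linarith)]
      linarith)
    have hq : (0 : ℝ) ≤ 4 * (((Biset.gamma f : ℝ) + 2) / ((α : ℝ) - 2)) :=
      mul_nonneg (by norm_num) (div_nonneg (by linarith) (by linarith))
    rcases exists_tightForest hf hx (fun e => (hnn e).lt_of_ne' (hne e).1) hlt1 with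
      ⟨v, hv, hd⟩ | ⟨F, hF⟩
    · have := Int.ceil_nonneg hq
      exact ⟨v, hv, by omega⟩
    -- D is an integer, so the strict bound with 6 becomes the weak bound with 5.
    · obtain ⟨v, hv, hd⟩ := hF.exists_degree_lt hα (fun e => (hne e).2)
        (D := ((⌈4 * (((Biset.gamma f : ℝ) + 2) / ((α : ℝ) - 2))⌉ + 6 : ℤ) : ℝ)) (by
          push_cast
          linarith [Int.le_ceil (4 * (((Biset.gamma f : ℝ) + 2) / ((α : ℝ) - 2)))])
      refine ⟨v, hv, ?_⟩
      have hd' : ((edgeCut ends (Biset.single v)).card : ℤ) <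
          ⌈4 * (((Biset.gamma f : ℝ) + 2) / ((α : ℝ) - 2))⌉ + 6 := by exact_mod_cast hd
      omega
  · intro hB
    rw [or_iff_not_imp_left]
    intro hne
    push Not at hne
    rcases exists_tightForest hf hx (fun e => (hnn e).lt_of_ne' (hne e).1)
      (fun e => (hne e).2.trans (by norm_num)) with ⟨v, hv, hd⟩ | ⟨F, hF⟩
    · have hd' : ((edgeCut ends (Biset.single v)).card : ℝ) ≤ 2 := by exact_mod_cast hd
      exact ⟨v, hv, hd'.trans (by nlinarith [sq_nonneg (Biset.gamma f : ℝ)])⟩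
    · exact hF.exists_degree_le (fun e => (hne e).2) hB
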